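/- Setting. Let $\Lambda=\{1,\dots,N\}$, let $p=(p_i)_{i\in\Lambda}$ satisfy $p_i>0$ and $\sum_i p_i=1$, and let $\mathbb I_i=\{f_i^1,\dots,f_i^{n_i}\}$ $(i\in\Lambda)$ be finite families of affine maps of $\mathbb R^2$ of the form $f_i^j(\mathbf x)=\operatorname{diag}(a_i^j,b_i^j)\,Q_i^j\,\mathbf x+(u_i^j,v_i^j)^\top$, where $0<a_i^j,b_i^j<1$, $Q_i^j$ is one of the eight matrices $\begin{pmatrix}\pm1&0\\0&\pm1\end{pmatrix}$, $\begin{pmatrix}0&\pm1\\\pm1&0\end{pmatrix}$, and $f_i^j(\Delta)\subseteq\Delta=[0,1]^2$. Assume $n_i\ge1$ for all $i$ and $n_i\ge2$ for at least one $i$. Let $\mu$ be the Bernoulli measure on $\Lambda^{\mathbb N}$ with weights $p$. For $\omega\in\Lambda^{\mathbb N}$ let $\mathbf C_\omega^k$ be the set of words $e=e_{\omega_1}^{j_1}\cdots e_{\omega_k}^{j_k}$ with $1\le j_l\le n_{\omega_l}$ (one word for each choice of indices), put $f(e,\cdot)=f_{\omega_1}^{j_1}\circ\dots\circ f_{\omega_k}^{j_k}$,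 and let $$F_\omega=\bigcap_{k\ge1}\ \bigcup_{e\in\mathbf C_\omega^k}f(e,\Delta).$$ Let $\alpha_M(e)$ and $\alpha_m(e)$ be the lengths of the longest and the shortest side of the rectangle $f(e,\Delta)$. Let $\overline s(e,F_\omega)$ and $\underline s(e,F_\omega)$ be the upper and the lower box-counting dimension of the orthogonal projection of $F_\omega$ to the coordinate axis parallel to the longest side of $f(e,\Delta)$ (the $x$-axis if the sides are equal). For $s\ge0$ put $$\overline\Psi_\omega^k(s)=\sum_{e\in\mathbf C_\omega^k}\alpha_M(e)^{\overline s(e,F_\omega)}\alpha_m(e)^{s-\overline s(e,F_\omega)},\qquad \overline P_\omega(s)=\limsup_{k\to\infty}\big(\overline\Psi_\omega^k(s)\big)^{1/k},$$ $$\underline\Psi_\omega^k(s)=\sum_{e\in\mathbf C_\omega^k}\alpha_M(e)^{\underline s(e,F_\omega)}\alpha_m(e)^{s-\underline s(e,F_\omega)},\qquad \underline P_\omega(s)=\liminf_{k\to\infty}\big(\underline\Psi_\omega^k(s)\big)^{1/k}.$$ Claim. There is a function $P:[0,\infty)\to[0,\infty)$, not depending on $\omega$, such that for $\mu$-almost every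 $\omega$ we have $\overline P_\omega(s)=\underline P_\omega(s)=P(s)$ for all $s\ge0$. The function $P$ is continuous and strictly decreasing, and there is a unique $s_B\in[0,\infty)$ with $P(s_B)=1$. -/

import Mathlib

open MeasureTheory Filter Topology
open scoped NNReal ENNReal

noncomputable section

namespace BoxLike

/-! ### Box-counting dimensions -/

/-- `N_δ(E)`: the least number of sets of diameter at most `δ` needed to cover `E`
(meaningful for totally bounded `E` and `δ > 0`, where finite covers exist). -/
def coverNumber {X : Type*} [MetricSpace X] (δ : ℝ) (E : Set X) : ℕ :=
  sInf {n : ℕ | ∃ U : Fin n → Set X,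
    (∀ i, Metric.ediam (U i) ≤ ENNReal.ofReal δ) ∧ E ⊆ ⋃ i, U i}

/-- The upper box-counting dimension, as an extended real number. -/
def upperBoxDim {X : Type*} [MetricSpace X] (E : Set X) : EReal :=
  limsup (fun δ : ℝ => ((Real.log (coverNumber δ E) / (-Real.log δ) : ℝ) : EReal)) (𝓝[>] 0)

/-- The lower box-counting dimension, as an extended real number. -/
def lowerBoxDim {X : Type*} [MetricSpace X] (E : Set X) : EReal :=
  liminf (fun δ : ℝ => ((Real.log (coverNumber δ E) / (-Real.log δ) : ℝ) : EReal)) (𝓝[>] 0)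

/-! ### Box-like maps and random iterated function systems -/

/-- The plane `ℝ²`; a point `z` has coordinates `z 0` (the `x` coordinate) and `z 1`. -/
abbrev Plane : Type := Fin 2 → ℝ

/-- The closed unit square `Δ = [0,1]²`. -/
def unitSquare : Set Plane := {z | ∀ c, z c ∈ Set.Icc (0 : ℝ) 1}

/-- The eight symmetries `diag(±1, ±1)` and `antidiag(±1, ±1)`, with independent signs. -/
def squareSymmetries : Set (Matrix (Fin 2) (Fin 2) ℝ) :=
  {Q | ∃ s t : ℝ, (s = 1 ∨ s = -1) ∧ (t = 1 ∨ t = -1) ∧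
    (Q = !![s, 0; 0, t] ∨ Q = !![0, s; t, 0])}

/-- The affine map `z ↦ diag(a, b) Q z + (u, v)`. -/
def affineMap (a b : ℝ) (Q : Matrix (Fin 2) (Fin 2) ℝ) (u v : ℝ) (z : Plane) : Plane :=
  Matrix.mulVec (!![a, 0; 0, b] * Q) z + ![u, v]

/-- A box-like affine contraction of the plane, mapping the unit square into itself. -/
structure BoxMap where
  a : ℝ
  b : ℝ
  Q : Matrix (Fin 2) (Fin 2) ℝ
  u : ℝ
  v : ℝ
  a_pos : 0 < a
  a_lt_one : a < 1
  b_pos : 0 < b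
  b_lt_one : b < 1
  Q_mem : Q ∈ squareSymmetries
  mapsTo : Set.MapsTo (affineMap a b Q u v) unitSquare unitSquare

/-- The underlying function of a box-like map. -/
def BoxMap.toFun (f : BoxMap) : Plane → Plane := affineMap f.a f.b f.Q f.u f.v

/-- A box-like random iterated function system: finitely many finite box-like IFSs, indexed by
`Fin N`, together with a non-degenerate probability vector `p`. -/
structure RIFS where
  N : ℕ
  numMaps : Fin N → ℕ
  map : (i : Fin N) → Fin (numMaps i) → BoxMap
  p : Fin N → ℝ
  p_pos : ∀ i, 0 < p i
  p_sum : ∑ i, p i = 1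

namespace RIFS

variable (R : RIFS)

/-! ### Realisations and the Bernoulli measure -/

/-- The space `Ω = Λ^ℕ` of realisations, with the product σ-algebra. The letters
`ω₁, ω₂, …` are `ω 0, ω 1, …`. -/
abbrev Coding : Type := ℕ → Fin R.N

/-- The law of one letter: the letter `i` has probability `p i`. -/
def letterLaw : Measure (Fin R.N) := ∑ i, ENNReal.ofReal (R.p i) • Measure.dirac i

instance : IsProbabilityMeasure R.letterLaw := by
  constructor
  simp only [letterLaw, Measure.coe_finsetSum, Finset.sum_apply, Measure.smul_apply,
    measure_univ, smul_eq_mul, mul_one]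
  rw [← ENNReal.ofReal_sum_of_nonneg (fun i _ => (R.p_pos i).le), R.p_sum, ENNReal.ofReal_one]

/-- The Bernoulli measure `μ` on `Ω`: the letters are independent with law `p`. -/
def bernoulli : Measure R.Coding := Measure.infinitePi (fun _ : ℕ => R.letterLaw)

/-! ### Words and the attractor -/

/-- The letters `e_i^j`, one for each map of each IFS. -/
abbrev Letter : Type := (i : Fin R.N) × Fin (R.numMaps i)

/-- Finite words in the letters `e_i^j`. -/
abbrev Word : Type := List R.Letter

/-- The image `f(e, K)` of a set under the composition of the maps coded by the word `e`, the
first letter being the outermost map. -/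
def wordImage : R.Word → Set Plane → Set Plane
  | [], K => K
  | e :: w, K => (R.map e.1 e.2).toFun '' wordImage w K

/-- Indices of the words of the `k`-level coding `C_ω^k`: the choice, for each `l < k`, of one of
the maps of the IFS named by the `l`-th letter of `ω`. -/
abbrev Level (ω : R.Coding) (k : ℕ) : Type := (l : Fin k) → Fin (R.numMaps (ω l))

/-- The word of `C_ω^k` with a given index. Distinct indices give distinct words, and every word
of `C_ω^k` occurs. -/
def levelWord (ω : R.Coding) (k : ℕ) (j : R.Level ω k) : R.Word :=
  List.ofFn fun l : Fin k => (⟨ω l, j l⟩ : R.Letter)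

/-- The 1-variable random carpet `F_ω = ⋂_{k ≥ 1} ⋃_{e ∈ C_ω^k} f(e, Δ)`. -/
def carpet (ω : R.Coding) : Set Plane :=
  ⋂ k ∈ Set.Ici (1 : ℕ), ⋃ j : R.Level ω k, R.wordImage (R.levelWord ω k j) unitSquare

/-! ### The modified singular value functions -/

/-- The length of the projection of the rectangle `f(e, Δ)` to the coordinate axis `c`; the
projection is a compact interval, so its length is its diameter. -/
def side (c : Fin 2) (e : R.Word) : ℝ :=
  Metric.diam ((fun z : Plane => z c) '' R.wordImage e unitSquare)

/-- `α_M(e)`, the length of the longest edge of `f(e, Δ)`. -/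
def longSide (e : R.Word) : ℝ := max (R.side 0 e) (R.side 1 e)

/-- `α_m(e)`, the length of the shortest edge of `f(e, Δ)`. -/
def shortSide (e : R.Word) : ℝ := min (R.side 0 e) (R.side 1 e)

open Classical in
/-- The axis parallel to the longest side of `f(e, Δ)` (the `x` axis in case of equality). -/
def longAxis (e : R.Word) : Fin 2 := if R.side 1 e ≤ R.side 0 e then 0 else 1

/-- The upper box-counting dimension of the projection of `F` to the line parallel to the longest
side of `f(e, Δ)`. -/
def upperProjDim (e : R.Word) (F : Set Plane) : ℝ :=
  (upperBoxDim ((fun z : Plane => z (R.longAxis e)) '' F)).toReal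

/-- The lower box-counting dimension of the projection of `F` to the line parallel to the longest
side of `f(e, Δ)`. -/
def lowerProjDim (e : R.Word) (F : Set Plane) : ℝ :=
  (lowerBoxDim ((fun z : Plane => z (R.longAxis e)) '' F)).toReal

/-- The upper modified singular value function. -/
def upperSV (ω : R.Coding) (s : ℝ) (e : R.Word) : ℝ :=
  R.longSide e ^ R.upperProjDim e (R.carpet ω) *
    R.shortSide e ^ (s - R.upperProjDim e (R.carpet ω))

/-- The lower modified singular value function. -/
def lowerSV (ω : R.Coding) (s : ℝ) (e : R.Word) : ℝ :=
  R.longSide e ^ R.lowerProjDim e (R.carpet ω) *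
    R.shortSide e ^ (s - R.lowerProjDim e (R.carpet ω))

/-- The sum of the upper modified singular values over all `k`-level words. -/
def upperSum (ω : R.Coding) (k : ℕ) (s : ℝ) : ℝ :=
  ∑ j : R.Level ω k, R.upperSV ω s (R.levelWord ω k j)

/-- The sum of the lower modified singular values over all `k`-level words. -/
def lowerSum (ω : R.Coding) (k : ℕ) (s : ℝ) : ℝ :=
  ∑ j : R.Level ω k, R.lowerSV ω s (R.levelWord ω k j)

/-! ### Pressures -/

/-- The upper `s`-pressure for the realisation `ω`. -/
def upperPressure (ω : R.Coding) (s : ℝ≥0) : ℝ≥0∞ :=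
  limsup (fun k : ℕ => ENNReal.ofReal (R.upperSum ω k s ^ (1 / (k : ℝ)))) atTop

/-- The lower `s`-pressure for the realisation `ω`. -/
def lowerPressure (ω : R.Coding) (s : ℝ≥0) : ℝ≥0∞ :=
  liminf (fun k : ℕ => ENNReal.ofReal (R.lowerSum ω k s ^ (1 / (k : ℝ)))) atTop

end RIFS

end BoxLike

end

/-! Two random inputs enter the pressure: the box dimensions of the two projections, and the sums of
singular values once those dimensions are known. Both are handled by one ergodic principle for the
Bernoulli shift, `StepProcess.exists_growth_rate`.

The principle concerns a process that can be concatenated along the shift, each step carrying a gain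
and a length, possibly with a finite state such as the current axis. For a slope `s`, consider the
event that gain minus `s` times length is unbounded above. Prefixing one letter costs a bounded
amount, so the event is backward invariant and `zero_one_of_skew` makes it trivial. If it is null,
gain is at most `s` times length plus a constant. If it is sure, steps of slope at least `s` start
from all but a small proportion of positions; chaining them, with single letters at the bad
positions, gives gain of any smaller slope up to a constant. The critical slope is the almost sure
growth rate.

For the projections, the gain is the logarithm of the number of words whose images are separated
along an axis, and the length is the logarithm of the inverse scale. Such families concatenate
(`SeparatedWords.trans`), bound covering numbers from below, and conversely are extracted from
separated subsets of the projection with a loss logarithmic in the inverse scale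
(`exists_separatedWords`). So the upper and lower dimensions coincide with the growth rate, which is
common to both axes as soon as some map interchanges them (`exists_box_dimensions`).

With fixed dimensions `d`, the singular value is a multiplicative factor times `max (ratio e 0)
(ratio e 1) ^ (d 0 + d 1 - s)`. The maximum is submultiplicative, so the level sums are sub- or
supermultiplicative according to the sign of the exponent, and the same principle with length equal
to the number of letters gives their exponential rate `L s`. Raising `s` by `δ` changes the
normalised logarithms by an amount between `δ * log lo` and `δ * log hi`, uniformly in the
realisation. This passes from rational to all `s`, makes `L` continuous and strictly decreasing, and
forces a zero because `0 ≤ L 0`. The pressure is `exp (L s)`. -/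

noncomputable section

namespace BoxLike
namespace RIFS

/-! ### The Bernoulli shift -/

section Shift

variable {R : RIFS}

/-- The realisation with first letter `i` that continues with `ω`. -/
def cons (i : Fin R.N) (ω : R.Coding) : R.Coding
  | 0 => i
  | n + 1 => ω n

/-- The realisation without its first `k` letters. -/
def shift (k : ℕ) (ω : R.Coding) : R.Coding := fun n => ω (n + k)

theorem shift_zero (ω : R.Coding) : shift 0 ω = ω := rfl

theorem measurable_cons (i : Fin R.N) : Measurable (cons (R := R) i) := by
  refine measurable_pi_lambda _ fun n => ?_
  cases n with
  | zero => exact measurable_const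
  | succ n => exact measurable_pi_apply n

theorem measurable_shift (k : ℕ) : Measurable (shift (R := R) k) :=
  measurable_pi_lambda _ fun n => measurable_pi_apply (n + k)

instance : IsProbabilityMeasure R.bernoulli := by
  unfold bernoulli
  infer_instance

theorem letterLaw_apply (A : Set (Fin R.N)) :
    R.letterLaw A = ∑ i, ENNReal.ofReal (R.p i) * A.indicator 1 i := by
  simp [letterLaw, Measure.finsetSum_apply]

/-- Cylinders over initial segments always involve coordinate 0, so the first letter can be split
off. -/
theorem pi_eq_pi_range {s : Finset ℕ} {n : ℕ} (h : s ⊆ Finset.range n)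
    (t : ℕ → Set (Fin R.N)) :
    Set.pi (s : Set ℕ) t =
      Set.pi (Finset.range n : Set ℕ) (fun l => if l ∈ s then t l else Set.univ) := by
  ext ω
  simp only [Set.mem_pi, Finset.mem_coe]
  constructor
  · intro H l _
    split_ifs with hl
    · exact H l hl
    · trivial
  · intro H l hl
    have := H l (h hl)
    rwa [if_pos hl] at this

/-- The Bernoulli measure splits off the first letter. -/
theorem bernoulli_eq_sum_map :
    R.bernoulli = ∑ i, ENNReal.ofReal (R.p i) • R.bernoulli.map (cons i) := by
  symm
  refine Measure.eq_infinitePi _ fun s t ht => ?_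
  obtain ⟨n, hn⟩ : ∃ n, s ⊆ Finset.range (n + 1) := by
    refine ⟨s.sup id, fun l hl => Finset.mem_range.2 (Nat.lt_succ_of_le ?_)⟩
    exact Finset.le_sup (f := id) hl
  rw [pi_eq_pi_range hn]
  set t' : ℕ → Set (Fin R.N) := fun l => if l ∈ s then t l else Set.univ with ht'
  have hm : ∀ l, MeasurableSet (t' l) := fun l => (Set.toFinite _).measurableSet
  have hprod : ∏ l ∈ s, R.letterLaw (t l) = ∏ l ∈ Finset.range (n + 1), R.letterLaw (t' l) := by
    rw [← Finset.prod_subset hn]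
    · refine Finset.prod_congr rfl fun l hl => ?_
      simp [ht', hl]
    · intro l _ hl
      simp [ht', hl]
  rw [hprod, Finset.prod_range_succ', letterLaw_apply, Finset.mul_sum]
  simp only [Measure.finsetSum_apply, Measure.smul_apply, smul_eq_mul]
  refine Finset.sum_congr rfl fun i _ => ?_
  rw [Measure.map_apply (measurable_cons i)
    (MeasurableSet.pi (Finset.countable_toSet _) fun l _ => hm l)]
  by_cases hi : i ∈ t' 0
  · have : cons i ⁻¹' Set.pi (Finset.range (n + 1) : Set ℕ) t' =
        Set.pi (Finset.range n : Set ℕ) (fun l => t' (l + 1)) := by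
      ext ω
      simp only [Set.mem_preimage, Set.mem_pi, Finset.mem_coe, Finset.mem_range]
      constructor
      · intro H l hl
        exact H (l + 1) (by omega)
      · intro H l hl
        cases l with
        | zero => exact hi
        | succ l => exact H l (by omega)
    rw [this, bernoulli, Measure.infinitePi_pi _ fun l _ => hm (l + 1)]
    simp [hi, mul_comm]
  · have : cons i ⁻¹' Set.pi (Finset.range (n + 1) : Set ℕ) t' = ∅ := by
      ext ω
      simp only [Set.mem_preimage, Set.mem_pi, Finset.mem_coe, Finset.mem_range,
        Set.mem_empty_iff_false, iff_false]
      intro H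
      exact hi (H 0 (by omega))
    rw [this]
    simp [hi]

theorem bernoulli_real_eq_sum {A : Set R.Coding} (hA : MeasurableSet A) :
    R.bernoulli.real A = ∑ i, R.p i * R.bernoulli.real (cons i ⁻¹' A) := by
  have h : R.bernoulli A = ∑ i, ENNReal.ofReal (R.p i) * R.bernoulli (cons i ⁻¹' A) := by
    conv_lhs => rw [bernoulli_eq_sum_map]
    simp only [Measure.finsetSum_apply, Measure.smul_apply, smul_eq_mul]
    exact Finset.sum_congr rfl fun i _ => by rw [Measure.map_apply (measurable_cons i) hA]
  rw [Measure.real, h, ENNReal.toReal_sum fun i _ =>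
    ENNReal.mul_ne_top ENNReal.ofReal_ne_top (measure_ne_top _ _)]
  refine Finset.sum_congr rfl fun i _ => ?_
  rw [ENNReal.toReal_mul, ENNReal.toReal_ofReal (R.p_pos i).le, Measure.real]

/-- Membership in `A` is determined by the first `n` letters. -/
def IsDetermined (n : ℕ) (A : Set R.Coding) : Prop :=
  ∀ ω ω' : R.Coding, (∀ l < n, ω l = ω' l) → ω ∈ A → ω' ∈ A

theorem IsDetermined.compl {n : ℕ} {A : Set R.Coding} (h : IsDetermined n A) :
    IsDetermined n Aᶜ :=
  fun ω ω' hω hA hA' => hA (h ω' ω (fun l hl => (hω l hl).symm) hA')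

theorem IsDetermined.mono {m n : ℕ} (hmn : m ≤ n) {A : Set R.Coding} (h : IsDetermined m A) :
    IsDetermined n A :=
  fun ω ω' hω hA => h ω ω' (fun l hl => hω l (by omega)) hA

theorem IsDetermined.measurableSet {n : ℕ} {A : Set R.Coding} (h : IsDetermined n A) :
    MeasurableSet A := by
  let f : R.Coding → (Fin n → Fin R.N) := fun ω l => ω l
  have hf : Measurable f := measurable_pi_lambda _ fun l => measurable_pi_apply (l : ℕ)
  have : A = f ⁻¹' (f '' A) := by
    refine Set.Subset.antisymm (Set.subset_preimage_image _ _) ?_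
    rintro ω ⟨ω', hω', he⟩
    exact h ω' ω (fun l hl => congrFun he ⟨l, hl⟩) hω'
  rw [this]
  exact hf (Set.toFinite _).measurableSet

theorem IsDetermined.cons_preimage {n : ℕ} {A : Set R.Coding} (h : IsDetermined (n + 1) A)
    (i : Fin R.N) : IsDetermined n (cons i ⁻¹' A) := by
  intro ω ω' hω hA
  refine h _ _ (fun l hl => ?_) hA
  cases l with
  | zero => rfl
  | succ l => exact hω l (by omega)

theorem IsDetermined.shift_preimage {n : ℕ} {A : Set R.Coding} (h : IsDetermined n A)
    (k : ℕ) : IsDetermined (n + k) (shift k ⁻¹' A) :=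
  fun ω ω' hω hA => h _ _ (fun l hl => hω (l + k) (by omega)) hA

/-- The first `n` letters are independent of the later ones. -/
theorem bernoulli_inter_shift {n : ℕ} {A B : Set R.Coding} (hA : IsDetermined n A)
    (hB : MeasurableSet B) :
    R.bernoulli.real (A ∩ shift n ⁻¹' B) = R.bernoulli.real A * R.bernoulli.real B := by
  induction n generalizing A with
  | zero =>
    rcases A.eq_empty_or_nonempty with rfl | ⟨ω, hω⟩
    · simp
    · have : A = Set.univ := Set.eq_univ_of_forall fun ω' => hA ω ω' (fun l hl => by omega) hω
      subst this
      simp only [Set.univ_inter, probReal_univ, one_mul]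
      rfl
  | succ n ih =>
    rw [bernoulli_real_eq_sum (hA.measurableSet.inter (measurable_shift _ hB)),
      bernoulli_real_eq_sum hA.measurableSet, Finset.sum_mul]
    refine Finset.sum_congr rfl fun i _ => ?_
    rw [mul_assoc, ← ih (hA.cons_preimage i)]
    rfl

theorem bernoulli_shift (n : ℕ) {B : Set R.Coding} (hB : MeasurableSet B) :
    R.bernoulli.real (shift n ⁻¹' B) = R.bernoulli.real B := by
  have := bernoulli_inter_shift (n := n) (A := Set.univ) (fun _ _ _ _ => trivial) hB
  simpa using this

end Shift

/-! ### Zero-one laws -/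

section ZeroOne

variable {R : RIFS}

/-- An event independent of every cylinder is trivial. -/
theorem zero_or_one_of_indep {E : Set R.Coding} (hE : MeasurableSet E)
    (h : ∀ n, ∀ A : Set R.Coding, IsDetermined n A →
      R.bernoulli.real (E ∩ A) = R.bernoulli.real E * R.bernoulli.real A) :
    R.bernoulli.real E = 0 ∨ R.bernoulli.real E = 1 := by
  by_cases h0 : R.bernoulli E = 0
  · left
    simp [Measure.real, h0]
  right
  have hr : R.bernoulli.real E ≠ 0 := by
    rw [Measure.real, ENNReal.toReal_ne_zero]
    exact ⟨h0, measure_ne_top _ _⟩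
  -- Conditioning on `E` does not change the measure of cylinders, hence changes nothing; but `E`
  -- itself has conditional measure 1.
  have key : ProbabilityTheory.cond R.bernoulli E = R.bernoulli := by
    refine Measure.eq_infinitePi _ fun s t ht => ?_
    obtain ⟨n, hn⟩ : ∃ n, s ⊆ Finset.range n := by
      refine ⟨s.sup id + 1, fun l hl => Finset.mem_range.2 (Nat.lt_succ_of_le ?_)⟩
      exact Finset.le_sup (f := id) hl
    have hd : IsDetermined n (Set.pi (s : Set ℕ) t : Set R.Coding) := by
      intro ω ω' hω H l hl
      rw [← hω l (Finset.mem_range.1 (hn hl))]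
      exact H l hl
    have h1 := h n _ hd
    rw [ProbabilityTheory.cond_apply hE, ← Measure.infinitePi_pi _ fun l _ => ht l]
    change _ = R.bernoulli (Set.pi (s : Set ℕ) t)
    have h2 : R.bernoulli (E ∩ Set.pi (s : Set ℕ) t) =
        R.bernoulli E * R.bernoulli (Set.pi (s : Set ℕ) t) := by
      rw [← ENNReal.toReal_eq_toReal_iff' (measure_ne_top _ _)
        (ENNReal.mul_ne_top (measure_ne_top _ _) (measure_ne_top _ _)), ENNReal.toReal_mul]
      exact h1
    rw [h2, ← mul_assoc, ENNReal.inv_mul_cancel h0 (measure_ne_top _ _), one_mul]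
  have h2 : R.bernoulli E = 1 := by
    rw [← key, ProbabilityTheory.cond_apply hE, Set.inter_self,
      ENNReal.inv_mul_cancel h0 (measure_ne_top _ _)]
  simp [Measure.real, h2]

variable {ι : Type*} [Finite ι]

/-- A zero-one law for a family of events that is backward invariant under a skew product over the
shift with finite fibre. -/
theorem zero_one_of_skew {E : ι → Set R.Coding} (hE : ∀ c, MeasurableSet (E c))
    (g : Fin R.N → ι → ι) (hg : ∀ c ω, shift 1 ω ∈ E (g (ω 0) c) → ω ∈ E c)
    (hirr : ∀ c c', c = c' ∨ ∃ i, g i c = c') :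
    (∀ c, R.bernoulli.real (E c) = 0) ∨ (∀ c, R.bernoulli.real (E c) = 1) := by
  rcases isEmpty_or_nonempty ι with hι | hι
  · exact Or.inl fun c => isEmptyElim c
  set q : ι → ℝ := fun c => R.bernoulli.real (E c) with hq
  have hstep : ∀ c i, q (g i c) ≤ R.bernoulli.real (cons i ⁻¹' E c) := by
    intro c i
    refine measureReal_mono ?_
    intro ω hω
    exact hg c (cons i ω) hω
  have hsum : ∀ c, ∑ i, R.p i * q (g i c) ≤ q c := by
    intro c
    rw [hq]
    simp only
    rw [bernoulli_real_eq_sum (hE c)]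
    exact Finset.sum_le_sum fun i _ => mul_le_mul_of_nonneg_left (hstep c i) (R.p_pos i).le
  obtain ⟨c₀, hc₀⟩ := Finite.exists_min q
  have hmin : ∀ i, q (g i c₀) = q c₀ := by
    have h1 : ∑ i, R.p i * (q (g i c₀) - q c₀) ≤ 0 := by
      simp only [mul_sub, Finset.sum_sub_distrib, ← Finset.sum_mul, R.p_sum, one_mul]
      linarith [hsum c₀]
    have h2 : ∀ i ∈ Finset.univ, 0 ≤ R.p i * (q (g i c₀) - q c₀) := fun i _ =>
      mul_nonneg (R.p_pos i).le (sub_nonneg.2 (hc₀ _))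
    intro i
    have h3 := (Finset.sum_eq_zero_iff_of_nonneg h2).1
      (le_antisymm h1 (Finset.sum_nonneg h2)) i (Finset.mem_univ i)
    rcases mul_eq_zero.1 h3 with h | h
    · exact absurd h (R.p_pos i).ne'
    · linarith
  have hconst : ∀ c, q c = q c₀ := by
    intro c
    rcases hirr c₀ c with h | ⟨i, h⟩
    · rw [h]
    · rw [← h, hmin i]
  have hcyl : ∀ n, ∀ A : Set R.Coding, IsDetermined n A → ∀ c,
      q c₀ * R.bernoulli.real A ≤ R.bernoulli.real (E c ∩ A) := by
    intro n
    induction n with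
    | zero =>
      intro A hA c
      rcases A.eq_empty_or_nonempty with rfl | ⟨ω, hω⟩
      · simp
      · have : A = Set.univ := Set.eq_univ_of_forall fun ω' => hA ω ω' (fun l hl => by omega) hω
        subst this
        simp only [Set.inter_univ, probReal_univ, mul_one]
        exact (hconst c).ge
    | succ n ih =>
      intro A hA c
      rw [bernoulli_real_eq_sum hA.measurableSet,
        bernoulli_real_eq_sum ((hE c).inter hA.measurableSet), Finset.mul_sum]
      refine Finset.sum_le_sum fun i _ => ?_
      rw [mul_left_comm]
      refine mul_le_mul_of_nonneg_left ?_ (R.p_pos i).le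
      refine (ih _ (hA.cons_preimage i) (g i c)).trans (measureReal_mono ?_)
      rintro ω ⟨h1, h2⟩
      exact ⟨hg c (cons i ω) h1, h2⟩
  -- The lower bounds of `hcyl` for `A` and `Aᶜ` already add up to the measure of `E c`, so both are
  -- equalities.
  have hindep : ∀ c n, ∀ A : Set R.Coding, IsDetermined n A →
      R.bernoulli.real (E c ∩ A) = R.bernoulli.real (E c) * R.bernoulli.real A := by
    intro c n A hA
    have h1 := hcyl n A hA c
    have h2 := hcyl n Aᶜ hA.compl c
    have h3 : R.bernoulli.real (E c ∩ A) + R.bernoulli.real (E c ∩ Aᶜ) = q c := by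
      rw [← Set.sdiff_eq]
      exact measureReal_inter_add_sdiff hA.measurableSet
    have h4 := hconst c
    rw [measureReal_compl hA.measurableSet, probReal_univ] at h2
    change _ = q c * _
    rw [h4] at h3 ⊢
    linarith
  rcases zero_or_one_of_indep (hE c₀) (hindep c₀) with h | h
  · exact Or.inl fun c => (hconst c).trans h
  · exact Or.inr fun c => (hconst c).trans h

end ZeroOne

/-! ### Visit frequencies of finitely determined events -/

section Frequency

variable {R : RIFS}

theorem sum_range_mul_eq (f : ℕ → ℝ) (M m : ℕ) :
    ∑ i ∈ Finset.range (m * M), f i =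
      ∑ j ∈ Finset.range M, ∑ i ∈ Finset.range m, f (i * M + j) := by
  induction m with
  | zero => simp
  | succ m ih =>
    rw [Nat.succ_mul, Finset.sum_range_add, ih, ← Finset.sum_add_distrib]
    exact Finset.sum_congr rfl fun j _ => (Finset.sum_range_succ _ _).symm

theorem indepFun_indicator_of_indepSet {Ω : Type*} [MeasurableSpace Ω] {μ : Measure Ω}
    {A B : Set Ω} (h : ProbabilityTheory.IndepSet A B μ) :
    ProbabilityTheory.IndepFun (A.indicator (1 : Ω → ℝ)) (B.indicator (1 : Ω → ℝ)) μ := by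
  have hle : ∀ s : Set Ω, MeasurableSpace.comap (s.indicator (1 : Ω → ℝ)) inferInstance ≤
      MeasurableSpace.generateFrom {s} := by
    intro s
    rw [← measurable_iff_comap_le]
    exact Measurable.indicator (m := MeasurableSpace.generateFrom {s}) measurable_const
      (MeasurableSpace.measurableSet_generateFrom rfl)
  exact ProbabilityTheory.indep_of_indep_of_le_left
    (ProbabilityTheory.indep_of_indep_of_le_right h (hle B)) (hle A)

/-- Along a progression with difference `M` an event determined by `M` letters has the right
frequency. -/
theorem tendsto_frequency_progression {M : ℕ} {A : Set R.Coding} (hA : IsDetermined M A)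
    (j : ℕ) :
    ∀ᵐ ω ∂(R.bernoulli), Tendsto (fun n : ℕ =>
      (∑ i ∈ Finset.range n, A.indicator (1 : R.Coding → ℝ) (shift (i * M + j) ω)) / n) atTop
      (𝓝 (R.bernoulli.real A)) := by
  have hm := hA.measurableSet
  set X : ℕ → R.Coding → ℝ := fun i ω => A.indicator (1 : R.Coding → ℝ) (shift (i * M + j) ω)
    with hX
  have hXi : ∀ i, X i = (shift (i * M + j) ⁻¹' A).indicator 1 := by
    intro i
    funext ω
    rfl
  have hms : ∀ i, MeasurableSet (shift (i * M + j) ⁻¹' A) := fun i => measurable_shift _ hm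
  have hmeas : ∀ i, Measurable (X i) := fun i => by
    rw [hXi]
    exact measurable_one.indicator (hms i)
  -- Positions at distance at least `M` read disjoint blocks of letters.
  have hpair : ∀ a b, a < b → ProbabilityTheory.IndepFun (X a) (X b) R.bernoulli := by
    intro a b hab
    rw [hXi a, hXi b]
    refine indepFun_indicator_of_indepSet ?_
    rw [ProbabilityTheory.indepSet_iff_measure_inter_eq_mul (hms a) (hms b) R.bernoulli]
    have h1 : IsDetermined (b * M + j) (shift (R := R) (a * M + j) ⁻¹' A) := by
      refine (hA.shift_preimage (a * M + j)).mono ?_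
      have := Nat.mul_le_mul_right M (Nat.succ_le_of_lt hab)
      rw [Nat.succ_mul] at this
      omega
    have h2 := bernoulli_inter_shift h1 hm
    rw [← bernoulli_shift (b * M + j) hm] at h2
    rw [← ENNReal.toReal_eq_toReal_iff' (measure_ne_top _ _)
        (ENNReal.mul_ne_top (measure_ne_top _ _) (measure_ne_top _ _)), ENNReal.toReal_mul]
    exact h2
  have hint : ∀ i, ∫ ω, X i ω ∂(R.bernoulli) = R.bernoulli.real A := by
    intro i
    rw [hXi, integral_indicator_one (hms i), bernoulli_shift _ hm]
  have hlaw : ∀ i, ProbabilityTheory.IdentDistrib (X i) (X 0) R.bernoulli R.bernoulli := by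
    intro i
    refine ⟨(hmeas i).aemeasurable, (hmeas 0).aemeasurable, ?_⟩
    ext B hB
    have hcomp : ∀ i, X i ⁻¹' B = shift (i * M + j) ⁻¹' (A.indicator (1 : R.Coding → ℝ) ⁻¹' B) :=
      fun i => rfl
    have hB' : MeasurableSet (A.indicator (1 : R.Coding → ℝ) ⁻¹' B) :=
      (measurable_one.indicator hm) hB
    rw [Measure.map_apply (hmeas i) hB, Measure.map_apply (hmeas 0) hB,
      ← ENNReal.toReal_eq_toReal_iff' (measure_ne_top _ _) (measure_ne_top _ _)]
    have := (bernoulli_shift (i * M + j) hB').trans (bernoulli_shift (0 * M + j) hB').symm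
    exact this
  have := ProbabilityTheory.strong_law_ae_real X
    (Integrable.congr ((integrable_const (1 : ℝ)).indicator (hms 0)) (by rw [hXi]; rfl))
    (fun a b hab => by
      rcases lt_or_gt_of_ne hab with h | h
      · exact hpair a b h
      · exact (hpair b a h).symm) hlaw
  rwa [hint] at this

/-- The number of visits to an event determined by finitely many letters. -/
theorem ae_visits_le {M : ℕ} {A : Set R.Coding} (hA : IsDetermined M A) {ε : ℝ}
    (hε : R.bernoulli.real A < ε) :
    ∀ᵐ ω ∂(R.bernoulli), ∃ κ : ℝ, ∀ n : ℕ,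
      ∑ i ∈ Finset.range n, A.indicator (1 : R.Coding → ℝ) (shift i ω) ≤ ε * n + κ := by
  -- The progressions below have difference `M + 1`, not `M`, so that the modulus is never zero.
  have hε0 : 0 ≤ ε := measureReal_nonneg.trans hε.le
  have hA' : IsDetermined (M + 1) A := hA.mono (Nat.le_succ M)
  have hall : ∀ᵐ ω ∂(R.bernoulli), ∀ j, Tendsto (fun n : ℕ =>
      (∑ i ∈ Finset.range n, A.indicator (1 : R.Coding → ℝ) (shift (i * (M + 1) + j) ω)) / n) atTop
      (𝓝 (R.bernoulli.real A)) :=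
    ae_all_iff.2 fun j => tendsto_frequency_progression hA' j
  filter_upwards [hall] with ω hω
  set f : ℕ → ℝ := fun i => A.indicator (1 : R.Coding → ℝ) (shift i ω) with hf
  have hf0 : ∀ i, 0 ≤ f i := fun i => Set.indicator_nonneg (fun _ _ => zero_le_one) _
  have hf1 : ∀ i, f i ≤ 1 := fun i => Set.indicator_le_self' (fun _ _ => zero_le_one) _
  have hj : ∀ j, ∃ n₀ : ℕ, ∀ n ≥ n₀,
      ∑ i ∈ Finset.range n, f (i * (M + 1) + j) ≤ ε * n := by
    intro j
    have h1 := (hω j).eventually_lt_const hε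
    obtain ⟨n₀, hn₀⟩ := eventually_atTop.1 h1
    refine ⟨max n₀ 1, fun n hn => ?_⟩
    have hpos : (0 : ℝ) < n := by exact_mod_cast (le_of_max_le_right hn)
    exact ((div_lt_iff₀ hpos).1 (hn₀ n (le_of_max_le_left hn))).le
  choose n₀ hn₀ using hj
  have hbound : ∀ j m, ∑ i ∈ Finset.range m, f (i * (M + 1) + j) ≤ ε * m + n₀ j := by
    intro j m
    rcases le_total (n₀ j) m with h | h
    · exact (hn₀ j m h).trans (le_add_of_nonneg_right (Nat.cast_nonneg _))
    · calc ∑ i ∈ Finset.range m, f (i * (M + 1) + j) ≤ ∑ _i ∈ Finset.range m, (1 : ℝ) :=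
          Finset.sum_le_sum fun i _ => hf1 _
        _ = m := by simp
        _ ≤ n₀ j := by exact_mod_cast h
        _ ≤ ε * m + n₀ j := le_add_of_nonneg_left (by positivity)
  -- The first term pays for rounding `n` up to a multiple of `M + 1`, the second for the initial
  -- stretch of each residue class.
  refine ⟨ε * (M + 1) + ∑ j ∈ Finset.range (M + 1), (n₀ j : ℝ), fun n => ?_⟩
  have hdiv : n ≤ (n / (M + 1) + 1) * (M + 1) := by
    have := Nat.lt_div_mul_add (a := n) (b := M + 1) (by omega)
    rw [Nat.add_mul, one_mul]
    omega
  have hdiv' : n / (M + 1) * (M + 1) ≤ n := Nat.div_mul_le_self _ _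
  calc ∑ i ∈ Finset.range n, f i
      ≤ ∑ i ∈ Finset.range ((n / (M + 1) + 1) * (M + 1)), f i :=
        Finset.sum_le_sum_of_subset_of_nonneg (Finset.range_mono hdiv) fun i _ _ => hf0 i
    _ ≤ ∑ j ∈ Finset.range (M + 1), (ε * ((n / (M + 1) + 1 : ℕ) : ℝ) + n₀ j) := by
        rw [sum_range_mul_eq]
        exact Finset.sum_le_sum fun j _ => hbound j _
    _ = ε * (((n / (M + 1) * (M + 1) : ℕ) : ℝ) + (M + 1)) +
          ∑ j ∈ Finset.range (M + 1), (n₀ j : ℝ) := by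
        rw [Finset.sum_add_distrib, Finset.sum_const, Finset.card_range, nsmul_eq_mul]
        push_cast
        ring
    _ ≤ ε * ((n : ℝ) + (M + 1)) + ∑ j ∈ Finset.range (M + 1), (n₀ j : ℝ) := by
        gcongr
    _ = _ := by ring

end Frequency

/-! ### Superadditive processes with variable step lengths -/

section Steps

/-- A superadditive process over the shift: `S ω c k t l c'` says that the process started at `ω` in
the state `c` can pass to `shift k ω` and the state `c'` with gain `t` and length `l`. -/
structure StepProcess (R : RIFS) (ι : Type*) where
  S : R.Coding → ι → ℕ → ℝ → ℝ → ι → Prop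
  next : Fin R.N → ι → ι
  loss : ℝ
  cost : ℝ
  rate : ℝ
  rate_pos : 0 < rate
  loss_nonneg : 0 ≤ loss
  cost_nonneg : 0 ≤ cost
  determined : ∀ ω ω' c k t l c', (∀ i < k, ω i = ω' i) → S ω c k t l c' → S ω' c k t l c'
  refl : ∀ ω c, S ω c 0 0 0 c
  -- A fallback that carries a walk past a position where no efficient step starts, at bounded
  -- expense.
  single : ∀ ω c, S ω c 1 (-loss) cost (next (ω 0) c)
  trans : ∀ ω c k t l c' k' t' l' c'', S ω c k t l c' → S (shift k ω) c' k' t' l' c'' →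
    S ω c (k + k') (t + t') (l + l') c''
  -- Losses are counted per letter; this lets them be absorbed into the slope per unit length.
  length_le : ∀ ω c k t l c', S ω c k t l c' → rate * k ≤ l
  connected : ∀ c c', c = c' ∨ ∃ i, next i c = c'

namespace StepProcess

variable {R : RIFS} {ι : Type*} (Γ : StepProcess R ι)

theorem length_nonneg {ω c k t l c'} (h : Γ.S ω c k t l c') : 0 ≤ l :=
  (mul_nonneg Γ.rate_pos.le (Nat.cast_nonneg k)).trans (Γ.length_le _ _ _ _ _ _ h)

/-- The realisations from which the gain exceeds `s` times the length by arbitrarily much. -/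
def unbounded (s : ℝ) (c : ι) : Set R.Coding :=
  {ω | ∀ K : ℕ, ∃ k t l c', 1 ≤ k ∧ Γ.S ω c k t l c' ∧ (K : ℝ) ≤ t - s * l}

theorem measurableSet_unbounded (s : ℝ) (c : ι) : MeasurableSet (Γ.unbounded s c) := by
  have : Γ.unbounded s c = ⋂ K : ℕ, ⋃ k : ℕ,
      {ω | ∃ t l c', 1 ≤ k ∧ Γ.S ω c k t l c' ∧ (K : ℝ) ≤ t - s * l} := by
    ext ω
    simp only [unbounded, Set.mem_ofPred_eq, Set.mem_iInter, Set.mem_iUnion]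
  rw [this]
  refine MeasurableSet.iInter fun K => MeasurableSet.iUnion fun k => ?_
  refine IsDetermined.measurableSet (n := k) ?_
  rintro ω ω' hω ⟨t, l, c', h1, h2, h3⟩
  exact ⟨t, l, c', h1, Γ.determined _ _ _ _ _ _ _ hω h2, h3⟩

/-- Prefixing a single letter changes gain minus `s` times length by a constant, which unboundedness
does not see. -/
theorem unbounded_of_shift (s : ℝ) (c : ι) (ω : R.Coding)
    (h : shift 1 ω ∈ Γ.unbounded s (Γ.next (ω 0) c)) : ω ∈ Γ.unbounded s c := by
  intro K
  obtain ⟨n, hn⟩ := exists_nat_ge ((K : ℝ) + Γ.loss + s * Γ.cost)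
  obtain ⟨k, t, l, c', h1, h2, h3⟩ := h n
  refine ⟨1 + k, -Γ.loss + t, Γ.cost + l, c', by omega,
    Γ.trans _ _ _ _ _ _ _ _ _ _ (Γ.single ω c) h2, ?_⟩
  have : s * (Γ.cost + l) = s * Γ.cost + s * l := by ring
  linarith

theorem unbounded_zero_one [Finite ι] (s : ℝ) :
    (∀ c, R.bernoulli.real (Γ.unbounded s c) = 0) ∨
      (∀ c, R.bernoulli.real (Γ.unbounded s c) = 1) :=
  zero_one_of_skew (Γ.measurableSet_unbounded s) Γ.next (Γ.unbounded_of_shift s) Γ.connected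

/-- The realisations from which, in every state, a step with at most `M` letters and length at most
`M` has gain at least `s` times its length. -/
def good (s : ℝ) (M : ℕ) : Set R.Coding :=
  {ω | ∀ c, ∃ (k : ℕ) (t l : ℝ) (c' : ι), 1 ≤ k ∧ k ≤ M ∧ l ≤ M ∧ Γ.S ω c k t l c' ∧ s * l ≤ t}

theorem isDetermined_good (s : ℝ) (M : ℕ) : IsDetermined M (Γ.good s M) := by
  intro ω ω' hω h c
  obtain ⟨k, t, l, c', h1, h2, h3, h4, h5⟩ := h c
  exact ⟨k, t, l, c', h1, h2, h3,
    Γ.determined _ _ _ _ _ _ _ (fun i hi => hω i (by omega)) h4, h5⟩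

theorem good_mono (s : ℝ) : Monotone (Γ.good s) := by
  intro M M' hM ω h c
  obtain ⟨k, t, l, c', h1, h2, h3, h4, h5⟩ := h c
  exact ⟨k, t, l, c', h1, h2.trans hM, h3.trans (by exact_mod_cast hM), h4, h5⟩

/-- Unboundedness, already at level 0, supplies a step of slope at least `s` from every state. With
finitely many states one size `M` serves them all, and continuity of the measure from below makes it
independent of the realisation up to a small exceptional event. -/
theorem exists_good_compl_lt [Finite ι] {s : ℝ}
    (hs : ∀ c, R.bernoulli.real (Γ.unbounded s c) = 1) {ε : ℝ} (hε : 0 < ε) :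
    ∃ M, R.bernoulli.real (Γ.good s M)ᶜ < ε := by
  have hsub : (⋂ c, Γ.unbounded s c) ⊆ ⋃ M, Γ.good s M := by
    intro ω hω
    rw [Set.mem_iInter] at hω
    have h : ∀ c, ∃ M : ℕ, ∃ (k : ℕ) (t l : ℝ) (c' : ι), 1 ≤ k ∧ k ≤ M ∧ l ≤ M ∧ Γ.S ω c k t l c' ∧ s * l ≤ t := by
      intro c
      obtain ⟨k, t, l, c', h1, h2, h3⟩ := hω c 0
      obtain ⟨n, hn⟩ := exists_nat_ge l
      refine ⟨max k n, k, t, l, c', h1, le_max_left _ _,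
        hn.trans (by exact_mod_cast le_max_right _ _), h2, ?_⟩
      push_cast at h3
      linarith
    choose M hM using h
    cases nonempty_fintype ι
    refine Set.mem_iUnion.2 ⟨Finset.univ.sup M, fun c => ?_⟩
    have hle : M c ≤ Finset.univ.sup M := Finset.le_sup (Finset.mem_univ c)
    obtain ⟨k, t, l, c', h1, h2, h3, h4, h5⟩ := hM c
    exact ⟨k, t, l, c', h1, h2.trans hle, h3.trans (by exact_mod_cast hle), h4, h5⟩
  have hae : ∀ᵐ ω ∂(R.bernoulli), ω ∈ ⋃ M, Γ.good s M := by
    have h1 : ∀ c, ∀ᵐ ω ∂(R.bernoulli), ω ∈ Γ.unbounded s c := fun c => by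
      have := hs c
      rw [Measure.real, ENNReal.toReal_eq_one_iff,
        ← prob_compl_eq_zero_iff (Γ.measurableSet_unbounded s c)] at this
      exact this
    filter_upwards [ae_all_iff.2 h1] with ω hω
    exact hsub (Set.mem_iInter.2 hω)
  have hlim := tendsto_measure_iUnion_atTop (μ := R.bernoulli) (Γ.good_mono s)
  have hone : R.bernoulli (⋃ M, Γ.good s M) = 1 := by
    rw [← prob_compl_eq_zero_iff
      (MeasurableSet.iUnion fun M => (Γ.isDetermined_good s M).measurableSet)]
    exact hae
  rw [hone] at hlim
  have hlim' := (ENNReal.tendsto_toReal ENNReal.one_ne_top).comp hlim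
  rw [ENNReal.toReal_one] at hlim'
  obtain ⟨M, hM⟩ := (hlim'.eventually_const_lt (show 1 - ε < 1 by linarith)).exists
  refine ⟨M, ?_⟩
  rw [measureReal_compl (Γ.isDetermined_good s M).measurableSet, probReal_univ]
  have : 1 - ε < R.bernoulli.real (Γ.good s M) := hM
  linarith

/-- Following good steps where possible and single letters otherwise. -/
theorem exists_walk {s : ℝ} {M : ℕ} (ω : R.Coding) (c : ι) {h : ℝ} (hh : 0 ≤ h) :
    ∃ k t l c', Γ.S ω c k t l c' ∧ l ≤ h ∧ h - (M + Γ.cost) ≤ l ∧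
      s * l - (Γ.loss + |s| * Γ.cost) *
        ∑ i ∈ Finset.range k, (Γ.good s M)ᶜ.indicator (1 : R.Coding → ℝ) (shift i ω) ≤ t := by
  set B : ℕ → ℝ := fun k =>
    ∑ i ∈ Finset.range k, (Γ.good s M)ᶜ.indicator (1 : R.Coding → ℝ) (shift i ω) with hB
  have hA : 0 ≤ Γ.loss + |s| * Γ.cost :=
    add_nonneg Γ.loss_nonneg (mul_nonneg (abs_nonneg s) Γ.cost_nonneg)
  have hBmono : Monotone B := by
    intro a b hab
    exact Finset.sum_le_sum_of_subset_of_nonneg (Finset.range_mono hab) fun i _ _ =>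
      Set.indicator_nonneg (fun _ _ => zero_le_one) _
  -- The walk stops once the remaining length is at most `M + cost`. Before that no step can
  -- overshoot `h`, since each has length at most `M` or exactly `cost`.
  have key : ∀ n : ℕ, ∃ k t l c', Γ.S ω c k t l c' ∧ l ≤ h ∧
      (h - (M + Γ.cost) ≤ l ∨ n ≤ k) ∧ s * l - (Γ.loss + |s| * Γ.cost) * B k ≤ t := by
    intro n
    induction n with
    | zero =>
      refine ⟨0, 0, 0, c, Γ.refl ω c, hh, Or.inr le_rfl, ?_⟩
      simp [hB]
    | succ n ih =>
      obtain ⟨k, t, l, c', h1, h2, h3, h4⟩ := ih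
      by_cases hl : h - (M + Γ.cost) ≤ l
      · exact ⟨k, t, l, c', h1, h2, Or.inl hl, h4⟩
      · have hk : n ≤ k := h3.resolve_left hl
        push Not at hl
        by_cases hg : shift k ω ∈ Γ.good s M
        · obtain ⟨k', t', l', c'', g1, g2, g3, g4, g5⟩ := hg c'
          have hc := Γ.cost_nonneg
          refine ⟨k + k', t + t', l + l', c'', Γ.trans _ _ _ _ _ _ _ _ _ _ h1 g4, by linarith,
            Or.inr (by omega), ?_⟩
          have := mul_le_mul_of_nonneg_left (hBmono (Nat.le_add_right k k')) hA
          rw [mul_add]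
          linarith
        · refine ⟨k + 1, t + -Γ.loss, l + Γ.cost, _, Γ.trans _ _ _ _ _ _ _ _ _ _ h1
            (Γ.single _ c'), ?_, Or.inr (by omega), ?_⟩
          · have : (0 : ℝ) ≤ M := Nat.cast_nonneg M
            linarith
          · have hBk : B (k + 1) = B k + 1 := by
              simp only [hB]
              rw [Finset.sum_range_succ, Set.indicator_of_mem (show shift k ω ∈ _ from hg)]
              rfl
            have hs := mul_le_mul_of_nonneg_right (le_abs_self s) Γ.cost_nonneg
            rw [hBk, mul_add, mul_add]
            linarith
  -- More than `h / rate` letters would have length exceeding `h`, so the walk must have stopped.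
  obtain ⟨n, hn⟩ := exists_nat_gt (h / Γ.rate)
  obtain ⟨k, t, l, c', h1, h2, h3, h4⟩ := key n
  refine ⟨k, t, l, c', h1, h2, h3.resolve_right ?_, h4⟩
  intro hk
  have := Γ.length_le _ _ _ _ _ _ h1
  rw [div_lt_iff₀ Γ.rate_pos] at hn
  have hk' : (n : ℝ) ≤ k := by exact_mod_cast hk
  have := mul_le_mul_of_nonneg_right hk' Γ.rate_pos.le
  linarith

/-- Along the walk of slope `s₁` only bad positions lose, by at most `A` each. When their frequency
is small compared with `(s₁ - s) * rate`, the linear part of the loss is paid for by lowering the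
slope to `s`. -/
theorem ae_lower [Finite ι] {s s₁ : ℝ} (hss : s < s₁)
    (hs : ∀ c, R.bernoulli.real (Γ.unbounded s₁ c) = 1) :
    ∀ᵐ ω ∂(R.bernoulli), ∃ κ : ℝ, ∀ c, ∀ h : ℝ, 0 ≤ h → ∃ k t l c', Γ.S ω c k t l c' ∧
      l ≤ h ∧ h - κ ≤ l ∧ s * l - κ ≤ t := by
  set A : ℝ := Γ.loss + |s₁| * Γ.cost with hAdef
  have hA : 0 ≤ A := add_nonneg Γ.loss_nonneg (mul_nonneg (abs_nonneg s₁) Γ.cost_nonneg)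
  -- `A + 1` rather than `A` since the loss per bad position may be zero.
  set ε : ℝ := (s₁ - s) * Γ.rate / (A + 1) with hεdef
  have hε : 0 < ε := div_pos (mul_pos (sub_pos.2 hss) Γ.rate_pos) (by linarith)
  obtain ⟨M, hM⟩ := Γ.exists_good_compl_lt hs hε
  filter_upwards [ae_visits_le (Γ.isDetermined_good s₁ M).compl hM] with ω ⟨κ, hκ⟩
  refine ⟨max (M + Γ.cost) (A * κ), fun c h hh => ?_⟩
  obtain ⟨k, t, l, c', h1, h2, h3, h4⟩ := Γ.exists_walk (s := s₁) (M := M) ω c hh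
  refine ⟨k, t, l, c', h1, h2, ?_, ?_⟩
  · have := le_max_left ((M : ℝ) + Γ.cost) (A * κ)
    linarith
  · have g1 := le_max_right ((M : ℝ) + Γ.cost) (A * κ)
    have g2 := mul_le_mul_of_nonneg_left (hκ k) hA
    have g3 : A * (ε * k) ≤ (s₁ - s) * l := by
      have e1 : A * ε ≤ (s₁ - s) * Γ.rate := by
        have : (A + 1) * ε = (s₁ - s) * Γ.rate := by
          rw [hεdef]
          field_simp
        linarith
      calc A * (ε * k) = A * ε * k := by ring
        _ ≤ (s₁ - s) * Γ.rate * k := mul_le_mul_of_nonneg_right e1 (Nat.cast_nonneg k)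
        _ = (s₁ - s) * (Γ.rate * k) := by ring
        _ ≤ (s₁ - s) * l :=
          mul_le_mul_of_nonneg_left (Γ.length_le _ _ _ _ _ _ h1) (sub_pos.2 hss).le
    rw [← hAdef] at h4
    linarith

/-- Almost surely the gain of the best steps grows like a constant times their length. -/
theorem exists_growth_rate [Finite ι] :
    ∃ β : EReal, ∀ᵐ ω ∂(R.bernoulli), ∀ c, ∀ s : ℝ,
      ((s : EReal) < β → ∃ κ : ℝ, ∀ h : ℝ, 0 ≤ h → ∃ k t l c', Γ.S ω c k t l c' ∧
        l ≤ h ∧ h - κ ≤ l ∧ s * l - κ ≤ t) ∧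
      (β < s → ∃ K : ℝ, ∀ k t l c', 1 ≤ k → Γ.S ω c k t l c' → t ≤ s * l + K) := by
  -- The critical slope, extended real because the set may be empty or unbounded. Above it the
  -- zero-one law makes the events null. Rational slopes keep the exceptional sets countable in
  -- number; nonnegative lengths make both bounds monotone in the slope.
  refine ⟨sSup {x | ∃ s : ℝ, x = s ∧ ∀ c, R.bernoulli.real (Γ.unbounded s c) = 1}, ?_⟩
  set T : Set EReal := {x | ∃ s : ℝ, x = s ∧ ∀ c, R.bernoulli.real (Γ.unbounded s c) = 1}
  have hlow : ∀ᵐ ω ∂(R.bernoulli), ∀ q : ℚ, ((q : ℝ) : EReal) < sSup T →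
      ∃ κ : ℝ, ∀ c, ∀ h : ℝ, 0 ≤ h → ∃ k t l c', Γ.S ω c k t l c' ∧
      l ≤ h ∧ h - κ ≤ l ∧ (q : ℝ) * l - κ ≤ t := by
    rw [ae_all_iff]
    intro q
    by_cases hq : ((q : ℝ) : EReal) < sSup T
    · obtain ⟨x, ⟨s₁, rfl, hs₁⟩, hx⟩ := lt_sSup_iff.1 hq
      filter_upwards [Γ.ae_lower (EReal.coe_lt_coe_iff.1 hx) hs₁] with ω hω _
      exact hω
    · exact Eventually.of_forall fun ω h => absurd h hq
  have hupp : ∀ᵐ ω ∂(R.bernoulli), ∀ q : ℚ, sSup T < ((q : ℝ) : EReal) →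
      ∀ c, ω ∉ Γ.unbounded q c := by
    rw [ae_all_iff]
    intro q
    by_cases hq : sSup T < ((q : ℝ) : EReal)
    · have h0 : ∀ c, R.bernoulli.real (Γ.unbounded q c) = 0 := by
        rcases Γ.unbounded_zero_one (q : ℝ) with h | h
        · exact h
        · exact absurd (le_sSup (show ((q : ℝ) : EReal) ∈ T from ⟨q, rfl, h⟩)) (not_le.2 hq)
      have : ∀ᵐ ω ∂(R.bernoulli), ∀ c, ω ∉ Γ.unbounded q c := by
        rw [ae_all_iff]
        intro c
        have := h0 c
        rw [Measure.real, ENNReal.toReal_eq_zero_iff] at this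
        exact measure_eq_zero_iff_ae_notMem.1 (this.resolve_right (measure_ne_top _ _))
      filter_upwards [this] with ω hω _
      exact hω
    · exact Eventually.of_forall fun ω h => absurd h hq
  filter_upwards [hlow, hupp] with ω h1 h2 c s
  constructor
  · intro hs
    obtain ⟨q, hq1, hq2⟩ := EReal.lt_iff_exists_rat_btwn.1 hs
    obtain ⟨κ, hκ⟩ := h1 q hq2
    refine ⟨κ, fun h hh => ?_⟩
    obtain ⟨k, t, l, c', g1, g2, g3, g4⟩ := hκ c h hh
    refine ⟨k, t, l, c', g1, g2, g3, ?_⟩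
    have := mul_le_mul_of_nonneg_right (EReal.coe_lt_coe_iff.1 hq1).le (Γ.length_nonneg g1)
    linarith
  · intro hs
    obtain ⟨q, hq1, hq2⟩ := EReal.lt_iff_exists_rat_btwn.1 hs
    have h3 := h2 q hq1 c
    simp only [unbounded, Set.mem_ofPred_eq, not_forall] at h3
    obtain ⟨K, hK⟩ := h3
    refine ⟨K, fun k t l c' hk hS => ?_⟩
    have h4 : ¬ ((K : ℝ) ≤ t - q * l) := fun h => hK ⟨k, t, l, c', hk, hS, h⟩
    have := mul_le_mul_of_nonneg_right (EReal.coe_lt_coe_iff.1 hq2).le (Γ.length_nonneg hS)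
    push Not at h4
    linarith

end StepProcess

end Steps

/-! ### The subadditive ergodic theorem as the one-state case -/

section Kingman

variable {R : RIFS}

/-- The step process of a superadditive sequence. -/
def superadditiveProcess (b : R.Coding → ℕ → ℝ) (A : ℝ) (hA : 0 ≤ A)
    (hdet : ∀ ω ω' k, (∀ i < k, ω i = ω' i) → b ω k = b ω' k)
    (hsuper : ∀ ω k l, b ω k + b (shift k ω) l ≤ b ω (k + l))
    (hbound : ∀ ω k, |b ω k| ≤ A * k) : StepProcess R Unit where
  S ω _ k t l _ := l = k ∧ t ≤ b ω k
  next _ c := c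
  loss := A
  cost := 1
  rate := 1
  rate_pos := one_pos
  loss_nonneg := hA
  cost_nonneg := zero_le_one
  determined ω ω' _ k t l _ h hS := ⟨hS.1, hdet ω ω' k h ▸ hS.2⟩
  refl ω _ := by
    have := hbound ω 0
    simp only [Nat.cast_zero, mul_zero] at this
    simp [abs_nonpos_iff.1 this]
  single ω _ := by
    have := neg_le_of_abs_le (hbound ω 1)
    simpa using this
  trans ω _ k t l _ k' t' l' _ h h' := by
    refine ⟨?_, (add_le_add h.2 h'.2).trans (hsuper ω k k')⟩
    rw [h.1, h'.1]
    push_cast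
    rfl
  length_le _ _ k t l _ h := by rw [h.1, one_mul]
  connected _ _ := Or.inl rfl

/-- The subadditive ergodic theorem for the Bernoulli shift, in superadditive form. -/
theorem exists_tendsto_of_superadditive (b : R.Coding → ℕ → ℝ) (A : ℝ)
    (hdet : ∀ ω ω' k, (∀ i < k, ω i = ω' i) → b ω k = b ω' k)
    (hsuper : ∀ ω k l, b ω k + b (shift k ω) l ≤ b ω (k + l))
    (hbound : ∀ ω k, |b ω k| ≤ A * k) :
    ∃ L : ℝ, ∀ᵐ ω ∂(R.bernoulli), Tendsto (fun n : ℕ => b ω n / n) atTop (𝓝 L) := by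
  have hA : 0 ≤ A := by
    obtain ⟨ω⟩ : Nonempty R.Coding := nonempty_of_isProbabilityMeasure R.bernoulli
    simpa using (abs_nonneg _).trans (hbound ω 1)
  obtain ⟨β, hβ⟩ := (superadditiveProcess b A hA hdet hsuper hbound).exists_growth_rate
  have hlower : ∀ ω k, -(A * k) ≤ b ω k := fun ω k => neg_le_of_abs_le (hbound ω k)
  have hupper : ∀ ω k, b ω k ≤ A * k := fun ω k => le_of_abs_le (hbound ω k)
  have hbelow : ((-A - 1 : ℝ) : EReal) ≤ β := by
    obtain ⟨ω, hω⟩ := hβ.exists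
    by_contra hlt
    push Not at hlt
    obtain ⟨K, hK⟩ := (hω () (-A - 1)).2 hlt
    obtain ⟨k, hk⟩ := exists_nat_gt (max K 1)
    have hk1 : 1 ≤ k := by exact_mod_cast (lt_of_le_of_lt (le_max_right _ _) hk).le
    have h1 := hK k (b ω k) k () hk1 ⟨rfl, le_rfl⟩
    have h2 := hlower ω k
    have h3 := lt_of_le_of_lt (le_max_left _ _) hk
    linarith
  have habove : β ≤ ((A + 1 : ℝ) : EReal) := by
    obtain ⟨ω, hω⟩ := hβ.exists
    by_contra hlt
    push Not at hlt
    obtain ⟨κ, hκ⟩ := (hω () (A + 1)).1 hlt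
    -- This target length forces `l ≥ κ + 1`, while slope `A + 1` against the bound `A * l` forces
    -- `l ≤ κ`.
    obtain ⟨k, t, l, c', ⟨h1, h2⟩, h3, h4, h5⟩ := hκ (max 0 (2 * κ + 1)) (le_max_left _ _)
    have h6 := hupper ω k
    have h7 := le_max_right (0 : ℝ) (2 * κ + 1)
    subst h1
    linarith
  lift β to ℝ using ⟨(habove.trans_lt (EReal.coe_lt_top _)).ne,
    ((EReal.bot_lt_coe _).trans_le hbelow).ne'⟩
  refine ⟨β, ?_⟩
  filter_upwards [hβ] with ω hω
  rw [tendsto_order]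
  constructor
  · intro a ha
    obtain ⟨s, hs1, hs2⟩ := exists_between ha
    obtain ⟨κ, hκ⟩ := (hω () s).1 (EReal.coe_lt_coe_iff.2 hs2)
    -- The walk stops at most `κ` letters short of `n`: the terms are the slope lost on those
    -- letters, the defect of the walk, and the worst value of `b` on the remainder.
    set C : ℝ := |s| * κ + κ + A * κ with hC
    have hbig : ∀ᶠ n : ℕ in atTop, C / (s - a) < n ∧ (0 : ℝ) < n :=
      (tendsto_natCast_atTop_atTop.eventually_gt_atTop _).and
        (tendsto_natCast_atTop_atTop.eventually_gt_atTop _)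
    filter_upwards [hbig] with n ⟨hn, hn0⟩
    rw [lt_div_iff₀ hn0]
    rw [div_lt_iff₀ (sub_pos.2 hs1)] at hn
    obtain ⟨k, t, l, c', ⟨h1, h2⟩, h3, h4, h5⟩ := hκ n hn0.le
    subst h1
    have hkn : k ≤ n := by exact_mod_cast h3
    obtain ⟨m, rfl⟩ := Nat.exists_eq_add_of_le hkn
    have h6 := hsuper ω k m
    have h7 := hlower (shift k ω) m
    push_cast at h4 hn ⊢
    have h8 : (m : ℝ) ≤ κ := by linarith
    have h9 : A * m ≤ A * κ := mul_le_mul_of_nonneg_left h8 hA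
    have h10 : s * m ≤ |s| * κ :=
      (mul_le_mul_of_nonneg_right (le_abs_self s) (Nat.cast_nonneg m)).trans
        (mul_le_mul_of_nonneg_left h8 (abs_nonneg s))
    linarith
  · intro a ha
    obtain ⟨s, hs1, hs2⟩ := exists_between ha
    obtain ⟨K, hK⟩ := (hω () s).2 (EReal.coe_lt_coe_iff.2 hs1)
    have hbig : ∀ᶠ n : ℕ in atTop, K / (a - s) < n ∧ (0 : ℝ) < n :=
      (tendsto_natCast_atTop_atTop.eventually_gt_atTop _).and
        (tendsto_natCast_atTop_atTop.eventually_gt_atTop _)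
    filter_upwards [hbig] with n ⟨hn, hn0⟩
    rw [div_lt_iff₀ hn0]
    rw [div_lt_iff₀ (sub_pos.2 hs2)] at hn
    have := hK n (b ω n) n () (by exact_mod_cast hn0) ⟨rfl, le_rfl⟩
    linarith

end Kingman

end RIFS

/-! ### Box-like maps in coordinates -/

/-- The factor by which the image of a box-like map is scaled along a coordinate axis. -/
def BoxMap.scale (f : BoxMap) (c : Fin 2) : ℝ := if c = 0 then f.a else f.b

open Classical in
/-- The coordinate of the argument on which a given coordinate of the image depends. -/
def BoxMap.perm (f : BoxMap) : Equiv.Perm (Fin 2) :=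
  if f.Q 0 0 = 0 then Equiv.swap 0 1 else 1

theorem BoxMap.scale_pos (f : BoxMap) (c : Fin 2) : 0 < f.scale c := by
  unfold BoxMap.scale
  split_ifs
  exacts [f.a_pos, f.b_pos]

theorem BoxMap.scale_lt_one (f : BoxMap) (c : Fin 2) : f.scale c < 1 := by
  unfold BoxMap.scale
  split_ifs
  exacts [f.a_lt_one, f.b_lt_one]

theorem BoxMap.exists_toFun_eq (f : BoxMap) (c : Fin 2) :
    ∃ κ t : ℝ, |κ| = f.scale c ∧ ∀ z, f.toFun z c = κ * z (f.perm c) + t := by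
  obtain ⟨s, t, hs, ht, hQ⟩ := f.Q_mem
  have hs1 : |s| = 1 := by rcases hs with rfl | rfl <;> simp
  have ht1 : |t| = 1 := by rcases ht with rfl | rfl <;> simp
  have hs0 : s ≠ 0 := by
    rintro rfl
    simp at hs1
  have ha := abs_of_pos f.a_pos
  have hb := abs_of_pos f.b_pos
  rcases hQ with hQ | hQ
  · have hp : f.perm = 1 := by
      rw [BoxMap.perm, if_neg]
      simpa [hQ] using hs0
    fin_cases c
    · refine ⟨f.a * s, f.u, by simp [abs_mul, hs1, ha, BoxMap.scale], fun z => ?_⟩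
      simp [BoxMap.toFun, affineMap, hp, hQ, dotProduct, Fin.sum_univ_two]
    · refine ⟨f.b * t, f.v, by simp [abs_mul, ht1, hb, BoxMap.scale], fun z => ?_⟩
      simp [BoxMap.toFun, affineMap, hp, hQ, dotProduct, Fin.sum_univ_two]
  · have hp : f.perm = Equiv.swap 0 1 := by
      rw [BoxMap.perm, if_pos]
      simp [hQ]
    fin_cases c
    · refine ⟨f.a * s, f.u, by simp [abs_mul, hs1, ha, BoxMap.scale], fun z => ?_⟩
      simp [BoxMap.toFun, affineMap, hp, hQ, dotProduct, Fin.sum_univ_two]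
    · refine ⟨f.b * t, f.v, by simp [abs_mul, ht1, hb, BoxMap.scale], fun z => ?_⟩
      simp [BoxMap.toFun, affineMap, hp, hQ, dotProduct, Fin.sum_univ_two]

theorem BoxMap.continuous_toFun (f : BoxMap) : Continuous f.toFun := by
  refine continuous_pi fun c => ?_
  obtain ⟨κ, t, -, h⟩ := f.exists_toFun_eq c
  simp only [h]
  fun_prop

theorem isCompact_unitSquare : IsCompact unitSquare := by
  have : unitSquare = Set.pi Set.univ (fun _ : Fin 2 => Set.Icc (0 : ℝ) 1) := by
    ext z
    simp only [unitSquare, Set.mem_pi, Set.mem_univ, true_imp_iff]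
    rfl
  rw [this]
  exact isCompact_univ_pi fun _ => isCompact_Icc

theorem const_mem_unitSquare {x : ℝ} (hx : x ∈ Set.Icc (0 : ℝ) 1) :
    (fun _ => x : Plane) ∈ unitSquare := fun _ => hx

namespace RIFS

/-! ### Words, their images and the carpet -/

section Words

variable {R : RIFS}

theorem exists_scale_bounds (R : RIFS) :
    ∃ lo hi : ℝ, 0 < lo ∧ lo < 1 ∧ 0 < hi ∧ hi < 1 ∧
      ∀ (e : R.Letter) c, lo ≤ (R.map e.1 e.2).scale c ∧ (R.map e.1 e.2).scale c ≤ hi := by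
  rcases isEmpty_or_nonempty (R.Letter × Fin 2) with h | h
  · exact ⟨1 / 2, 1 / 2, by norm_num, by norm_num, by norm_num, by norm_num,
      fun e c => h.elim (e, c)⟩
  · let f : R.Letter × Fin 2 → ℝ := fun x => (R.map x.1.1 x.1.2).scale x.2
    obtain ⟨x, hx⟩ := Finite.exists_min f
    obtain ⟨y, hy⟩ := Finite.exists_max f
    exact ⟨f x, f y, BoxMap.scale_pos _ _, BoxMap.scale_lt_one _ _, BoxMap.scale_pos _ _,
      BoxMap.scale_lt_one _ _, fun e c => ⟨hx (e, c), hy (e, c)⟩⟩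

/-- A lower bound in `(0, 1)` for the scaling factors of all maps. -/
def lo (R : RIFS) : ℝ := R.exists_scale_bounds.choose

/-- An upper bound in `(0, 1)` for the scaling factors of all maps. -/
def hi (R : RIFS) : ℝ := R.exists_scale_bounds.choose_spec.choose

theorem scale_bounds_spec (R : RIFS) : 0 < R.lo ∧ R.lo < 1 ∧ 0 < R.hi ∧ R.hi < 1 ∧
    ∀ (e : R.Letter) c, R.lo ≤ (R.map e.1 e.2).scale c ∧ (R.map e.1 e.2).scale c ≤ R.hi :=
  R.exists_scale_bounds.choose_spec.choose_spec

theorem lo_pos (R : RIFS) : 0 < R.lo := R.scale_bounds_spec.1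

theorem lo_lt_one (R : RIFS) : R.lo < 1 := R.scale_bounds_spec.2.1

theorem hi_pos (R : RIFS) : 0 < R.hi := R.scale_bounds_spec.2.2.1

theorem hi_lt_one (R : RIFS) : R.hi < 1 := R.scale_bounds_spec.2.2.2.1

theorem lo_le_scale (e : R.Letter) (c : Fin 2) : R.lo ≤ (R.map e.1 e.2).scale c :=
  (R.scale_bounds_spec.2.2.2.2 e c).1

theorem scale_le_hi (e : R.Letter) (c : Fin 2) : (R.map e.1 e.2).scale c ≤ R.hi :=
  (R.scale_bounds_spec.2.2.2.2 e c).2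

/-- The composition of the maps coded by a word. -/
def wordMap : R.Word → Plane → Plane
  | [], z => z
  | e :: w, z => (R.map e.1 e.2).toFun (wordMap w z)

/-- The coordinate of the argument on which a given coordinate of the image depends. -/
def axis : R.Word → Equiv.Perm (Fin 2)
  | [] => 1
  | e :: w => (R.map e.1 e.2).perm.trans (axis w)

/-- The factor by which the image of a word is scaled along a coordinate axis. -/
def ratio : R.Word → Fin 2 → ℝ
  | [], _ => 1
  | e :: w, c => (R.map e.1 e.2).scale c * ratio w ((R.map e.1 e.2).perm c)

theorem wordImage_eq (e : R.Word) (K : Set Plane) : R.wordImage e K = wordMap e '' K := by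
  induction e with
  | nil => exact (Set.image_id K).symm
  | cons e w ih =>
    rw [wordImage, ih, Set.image_image]
    rfl

theorem wordMap_append (u v : R.Word) (z : Plane) :
    wordMap (u ++ v) z = wordMap u (wordMap v z) := by
  induction u with
  | nil => rfl
  | cons e w ih =>
    rw [List.cons_append, wordMap, ih]
    rfl

theorem axis_append (u v : R.Word) (c : Fin 2) : axis (u ++ v) c = axis v (axis u c) := by
  induction u generalizing c with
  | nil => rfl
  | cons e w ih => exact ih _

theorem ratio_append (u v : R.Word) (c : Fin 2) :
    ratio (u ++ v) c = ratio u c * ratio v (axis u c) := by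
  induction u generalizing c with
  | nil => exact (one_mul _).symm
  | cons e w ih =>
    rw [List.cons_append, ratio, ih, ← mul_assoc]
    rfl

theorem ratio_pos (e : R.Word) (c : Fin 2) : 0 < ratio e c := by
  induction e generalizing c with
  | nil => exact one_pos
  | cons e w ih => exact mul_pos (BoxMap.scale_pos _ _) (ih _)

theorem lo_pow_le_ratio (e : R.Word) (c : Fin 2) : R.lo ^ e.length ≤ ratio e c := by
  induction e generalizing c with
  | nil => exact le_rfl
  | cons e w ih =>
    rw [List.length_cons, pow_succ']
    exact mul_le_mul (lo_le_scale e c) (ih _) (pow_nonneg R.lo_pos.le _) (BoxMap.scale_pos _ _).le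

theorem ratio_le_hi_pow (e : R.Word) (c : Fin 2) : ratio e c ≤ R.hi ^ e.length := by
  induction e generalizing c with
  | nil => exact le_rfl
  | cons e w ih =>
    rw [List.length_cons, pow_succ']
    exact mul_le_mul (scale_le_hi e c) (ih _) (ratio_pos _ _).le R.hi_pos.le

theorem ratio_le_one (e : R.Word) (c : Fin 2) : ratio e c ≤ 1 :=
  (ratio_le_hi_pow e c).trans (pow_le_one₀ R.hi_pos.le R.hi_lt_one.le)

theorem exists_wordMap_eq (e : R.Word) (c : Fin 2) :
    ∃ κ t : ℝ, |κ| = ratio e c ∧ ∀ z, wordMap e z c = κ * z (axis e c) + t := by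
  induction e generalizing c with
  | nil => exact ⟨1, 0, abs_one, fun z => by simp [wordMap, axis]⟩
  | cons e w ih =>
    obtain ⟨κ, t, h1, h2⟩ := (R.map e.1 e.2).exists_toFun_eq c
    obtain ⟨κ', t', h3, h4⟩ := ih ((R.map e.1 e.2).perm c)
    refine ⟨κ * κ', κ * t' + t, by rw [abs_mul, h1, h3]; rfl, fun z => ?_⟩
    rw [wordMap, h2, h4, axis, Equiv.trans_apply]
    ring

theorem abs_wordMap_sub (e : R.Word) (c : Fin 2) (z z' : Plane) :
    |wordMap e z c - wordMap e z' c| = ratio e c * |z (axis e c) - z' (axis e c)| := by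
  obtain ⟨κ, t, h1, h2⟩ := exists_wordMap_eq e c
  rw [h2, h2, ← h1, ← abs_mul]
  congr 1
  ring

theorem wordMap_mem (e : R.Word) {z : Plane} (hz : z ∈ unitSquare) :
    wordMap e z ∈ unitSquare := by
  induction e with
  | nil => exact hz
  | cons e w ih => exact (R.map e.1 e.2).mapsTo ih

theorem continuous_wordMap (e : R.Word) : Continuous (wordMap e) := by
  induction e with
  | nil => exact continuous_id
  | cons e w ih => exact (BoxMap.continuous_toFun _).comp ih

theorem wordImage_append_subset (u v : R.Word) :
    R.wordImage (u ++ v) unitSquare ⊆ R.wordImage u unitSquare := by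
  rw [wordImage_eq, wordImage_eq]
  rintro _ ⟨z, hz, rfl⟩
  exact ⟨wordMap v z, wordMap_mem v hz, (wordMap_append u v z).symm⟩

/-- The images of the corners `(0, 0)` and `(1, 1)` realise the diameter along both axes at once. -/
theorem side_eq (c : Fin 2) (e : R.Word) : R.side c e = ratio e c := by
  have hb : Bornology.IsBounded ((fun z : Plane => z c) '' R.wordImage e unitSquare) := by
    refine (Metric.isBounded_Icc (0 : ℝ) 1).subset ?_
    rw [wordImage_eq]
    rintro _ ⟨_, ⟨z, hz, rfl⟩, rfl⟩
    exact wordMap_mem e hz c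
  refine le_antisymm (Metric.diam_le_of_forall_dist_le (ratio_pos e c).le ?_) ?_
  · rw [wordImage_eq]
    rintro _ ⟨_, ⟨z, hz, rfl⟩, rfl⟩ _ ⟨_, ⟨z', hz', rfl⟩, rfl⟩
    rw [Real.dist_eq, abs_wordMap_sub]
    refine mul_le_of_le_one_right (ratio_pos e c).le ?_
    have h1 := hz (axis e c)
    have h2 := hz' (axis e c)
    rw [abs_le]
    constructor <;> linarith [h1.1, h1.2, h2.1, h2.2]
  · have h0 := const_mem_unitSquare (x := 0) ⟨le_rfl, zero_le_one⟩
    have h1 := const_mem_unitSquare (x := 1) ⟨zero_le_one, le_rfl⟩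
    have := Metric.dist_le_diam_of_mem hb
      (show wordMap e (fun _ => 1) c ∈ _ from ⟨_, by rw [wordImage_eq]; exact ⟨_, h1, rfl⟩, rfl⟩)
      (show wordMap e (fun _ => 0) c ∈ _ from ⟨_, by rw [wordImage_eq]; exact ⟨_, h0, rfl⟩, rfl⟩)
    rwa [Real.dist_eq, abs_wordMap_sub, sub_zero, abs_one, mul_one] at this

/-- The word `e` belongs to the coding of `ω` at the level given by its length. -/
def Codes : R.Word → R.Coding → Prop
  | [], _ => True
  | e :: w, ω => e.1 = ω 0 ∧ Codes w (shift 1 ω)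

theorem codes_append (u v : R.Word) (ω : R.Coding) :
    Codes (u ++ v) ω ↔ Codes u ω ∧ Codes v (shift u.length ω) := by
  induction u generalizing ω with
  | nil => simp [Codes, shift_zero]
  | cons e w ih =>
    rw [List.cons_append, Codes, Codes, ih, and_assoc]
    rfl

theorem codes_congr {e : R.Word} {ω ω' : R.Coding} (h : ∀ i < e.length, ω i = ω' i)
    (he : Codes e ω) : Codes e ω' := by
  induction e generalizing ω ω' with
  | nil => trivial
  | cons e w ih =>
    refine ⟨he.1.trans (h 0 (Nat.succ_pos _)), ih (fun i hi => ?_) he.2⟩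
    exact h (i + 1) (Nat.succ_lt_succ hi)

theorem levelWord_succ (ω : R.Coding) (k : ℕ) (j : R.Level ω (k + 1)) :
    R.levelWord ω (k + 1) j =
      ⟨ω 0, j 0⟩ :: R.levelWord (shift 1 ω) k (fun l => j l.succ) := by
  rw [levelWord, List.ofFn_succ]
  rfl

theorem length_levelWord (ω : R.Coding) (k : ℕ) (j : R.Level ω k) :
    (R.levelWord ω k j).length = k := List.length_ofFn

theorem codes_levelWord (ω : R.Coding) (k : ℕ) (j : R.Level ω k) :
    Codes (R.levelWord ω k j) ω := by
  induction k generalizing ω with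
  | zero => trivial
  | succ k ih =>
    rw [levelWord_succ]
    exact ⟨rfl, ih (shift 1 ω) _⟩

theorem exists_levelWord_eq {e : R.Word} {ω : R.Coding} (he : Codes e ω) :
    ∃ j, R.levelWord ω e.length j = e := by
  induction e generalizing ω with
  | nil => exact ⟨fun l => l.elim0, rfl⟩
  | cons e w ih =>
    obtain ⟨i, a⟩ := e
    obtain ⟨hi, hw⟩ := he
    obtain ⟨j, hj⟩ := ih hw
    dsimp only at hi
    subst hi
    refine ⟨fun l => Fin.cases (motive := fun l => Fin (R.numMaps (ω l))) a j l, ?_⟩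
    exact (levelWord_succ ω w.length _).trans (congrArg₂ _ rfl hj)

theorem mem_carpet {ω : R.Coding} {z : Plane} :
    z ∈ R.carpet ω ↔
      ∀ k, 1 ≤ k → ∃ e, e.length = k ∧ Codes e ω ∧ z ∈ R.wordImage e unitSquare := by
  simp only [carpet, Set.mem_iInter, Set.mem_iUnion, Set.mem_Ici]
  refine forall₂_congr fun k _ => ⟨?_, ?_⟩
  · rintro ⟨j, hj⟩
    exact ⟨_, length_levelWord ω k j, codes_levelWord ω k j, hj⟩
  · rintro ⟨e, rfl, he, hz⟩
    obtain ⟨j, hj⟩ := exists_levelWord_eq he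
    exact ⟨j, by rwa [hj]⟩

theorem carpet_subset (ω : R.Coding) : R.carpet ω ⊆ unitSquare := by
  intro z hz
  obtain ⟨e, -, -, he⟩ := mem_carpet.1 hz 1 le_rfl
  rw [wordImage_eq] at he
  obtain ⟨y, hy, rfl⟩ := he
  exact wordMap_mem e hy

/-- Always using the first map of each family gives nested nonempty compact rectangles. -/
theorem carpet_nonempty (hone : ∀ i, 1 ≤ R.numMaps i) (ω : R.Coding) : (R.carpet ω).Nonempty := by
  set w : ℕ → R.Word := fun n => R.levelWord ω n (fun l => ⟨0, hone (ω l)⟩) with hw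
  have hstep : ∀ n, w (n + 1) = w n ++ [⟨ω n, ⟨0, hone (ω n)⟩⟩] := by
    intro n
    simp only [hw, levelWord]
    rw [List.ofFn_succ', List.concat_eq_append]
    rfl
  have hc : ∀ n, IsCompact (R.wordImage (w n) unitSquare) := fun n => by
    rw [wordImage_eq]
    exact isCompact_unitSquare.image (continuous_wordMap _)
  obtain ⟨z, hz⟩ := IsCompact.nonempty_iInter_of_sequence_nonempty_isCompact_isClosed
    (fun n => R.wordImage (w n) unitSquare)
    (fun n => by
      simp only [hstep]
      exact wordImage_append_subset _ _)
    (fun n => by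
      rw [wordImage_eq]
      exact Set.Nonempty.image _ ⟨_, const_mem_unitSquare (x := 0) ⟨le_rfl, zero_le_one⟩⟩)
    (hc 0) (fun n => (hc n).isClosed)
  rw [Set.mem_iInter] at hz
  exact ⟨z, mem_carpet.2 fun k _ => ⟨w k, length_levelWord _ _ _, codes_levelWord _ _ _, hz k⟩⟩

/-- At levels up to the length of `e` a prefix of `e` suffices, by nesting; at deeper levels `e` is
extended by a word witnessing that `z` lies in the shifted carpet. -/
theorem wordMap_mem_carpet {e : R.Word} {ω : R.Coding} (he : Codes e ω) {z : Plane}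
    (hz : z ∈ R.carpet (shift e.length ω)) : wordMap e z ∈ R.carpet ω := by
  refine mem_carpet.2 fun k _ => ?_
  rcases le_or_gt k e.length with h | h
  · have hk := List.take_append_drop k e
    rw [← hk, codes_append] at he
    refine ⟨e.take k, List.length_take_of_le h, he.1, ?_⟩
    refine wordImage_append_subset (e.take k) (e.drop k) ?_
    rw [hk, wordImage_eq]
    exact ⟨z, carpet_subset _ hz, rfl⟩
  · obtain ⟨v, hv, hc, hi⟩ := mem_carpet.1 hz (k - e.length) (by omega)
    refine ⟨e ++ v, by rw [List.length_append]; omega, (codes_append e v ω).2 ⟨he, hc⟩, ?_⟩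
    rw [wordImage_eq] at hi ⊢
    obtain ⟨y, hy, rfl⟩ := hi
    exact ⟨y, hy, wordMap_append e v y⟩

theorem exists_wordMap_mem_carpet (hone : ∀ i, 1 ≤ R.numMaps i) {e : R.Word} {ω : R.Coding}
    (he : Codes e ω) : ∃ y ∈ unitSquare, wordMap e y ∈ R.carpet ω := by
  obtain ⟨z, hz⟩ := carpet_nonempty hone (shift e.length ω)
  exact ⟨z, carpet_subset _ hz, wordMap_mem_carpet he hz⟩

end Words

end RIFS

/-! ### Covering numbers of subsets of the unit interval -/

/-- A separated set that is not a net can be enlarged; were there never a net, separated sets would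
be arbitrarily large, contradicting the pigeonhole principle. -/
theorem exists_separated_net {X : Set ℝ} (hX : X ⊆ Set.Icc 0 1) {δ : ℝ} (hδ : 0 < δ) :
    ∃ P : Finset ℝ, (P : Set ℝ) ⊆ X ∧ (∀ x ∈ P, ∀ y ∈ P, x ≠ y → δ ≤ |x - y|) ∧
      ∀ x ∈ X, ∃ y ∈ P, |x - y| < δ := by
  by_contra hno
  push Not at hno
  have hall : ∀ n : ℕ, ∃ P : Finset ℝ, P.card = n ∧ (P : Set ℝ) ⊆ X ∧
      ∀ x ∈ P, ∀ y ∈ P, x ≠ y → δ ≤ |x - y| := by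
    intro n
    induction n with
    | zero => exact ⟨∅, rfl, by simp, by simp⟩
    | succ n ih =>
      obtain ⟨P, hP, hPX, hsep⟩ := ih
      obtain ⟨x, hx, hxP⟩ := hno P hPX hsep
      have hxn : x ∉ P := fun h => by
        have := hxP x h
        rw [sub_self, abs_zero] at this
        linarith
      refine ⟨insert x P, by rw [Finset.card_insert_of_notMem hxn, hP], ?_, ?_⟩
      · rw [Finset.coe_insert]
        exact Set.insert_subset hx hPX
      · intro y hy z hz hyz
        rcases Finset.mem_insert.1 hy with rfl | hy' <;>
          rcases Finset.mem_insert.1 hz with rfl | hz'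
        · exact absurd rfl hyz
        · exact hxP z hz'
        · rw [abs_sub_comm]
          exact hxP y hy'
        · exact hsep y hy' z hz' hyz
  -- One more point than there are cells `⌊x / δ⌋₊`.
  obtain ⟨P, hP, hPX, hsep⟩ := hall (⌊1 / δ⌋₊ + 2)
  have hmaps : Set.MapsTo (fun x : ℝ => ⌊x / δ⌋₊) P (Finset.range (⌊1 / δ⌋₊ + 1)) := by
    intro x hx
    refine Finset.mem_coe.2 (Finset.mem_range.2 (Nat.lt_succ_of_le (Nat.floor_le_floor ?_)))
    exact div_le_div_of_nonneg_right (hX (hPX hx)).2 hδ.le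
  obtain ⟨x, hx, y, hy, hxy, he⟩ := Finset.exists_ne_map_eq_of_card_lt_of_maps_to
    (by rw [Finset.card_range, hP]; omega) hmaps
  have h0 : ∀ x ∈ P, 0 ≤ x / δ := fun x hx => div_nonneg (hX (hPX hx)).1 hδ.le
  have h1 := Nat.floor_le (h0 x hx)
  have h2 := Nat.floor_le (h0 y hy)
  have h3 := Nat.lt_floor_add_one (x / δ)
  have h4 := Nat.lt_floor_add_one (y / δ)
  rw [show ⌊x / δ⌋₊ = ⌊y / δ⌋₊ from he] at h1 h3
  have h5 : |x / δ - y / δ| < 1 := by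
    rw [abs_lt]
    constructor <;> linarith
  rw [← sub_div, abs_div, abs_of_pos hδ, div_lt_one hδ] at h5
  exact absurd (hsep x hx y hy hxy) (not_le.2 h5)

theorem exists_cover_of_net {X : Set ℝ} {δ : ℝ} {P : Finset ℝ}
    (hP : ∀ x ∈ X, ∃ y ∈ P, |x - y| < δ) :
    P.card ∈ {n : ℕ | ∃ U : Fin n → Set ℝ,
      (∀ i, Metric.ediam (U i) ≤ ENNReal.ofReal (2 * δ)) ∧ X ⊆ ⋃ i, U i} := by
  refine ⟨fun i => Metric.closedBall (P.equivFin.symm i : ℝ) δ, fun i => ?_, fun x hx => ?_⟩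
  · refine Metric.ediam_le fun x hx y hy => ?_
    rw [edist_dist]
    refine ENNReal.ofReal_le_ofReal ?_
    have := dist_triangle_right x y (P.equivFin.symm i : ℝ)
    rw [Metric.mem_closedBall] at hx hy
    linarith
  · obtain ⟨y, hy, hxy⟩ := hP x hx
    refine Set.mem_iUnion.2 ⟨P.equivFin ⟨y, hy⟩, ?_⟩
    simp only [Equiv.symm_apply_apply, Metric.mem_closedBall, Real.dist_eq]
    exact hxy.le

theorem coverNumber_le_card {X : Set ℝ} {δ : ℝ} {P : Finset ℝ}
    (hP : ∀ x ∈ X, ∃ y ∈ P, |x - y| < δ) : coverNumber (2 * δ) X ≤ P.card :=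
  Nat.sInf_le (exists_cover_of_net hP)

/-- A finite net shows that the set of admissible cardinalities is nonempty, so the infimum is
attained and is not the default value 0 of `sInf ∅`. -/
theorem exists_optimal_cover {X : Set ℝ} (hX : X ⊆ Set.Icc 0 1) {δ : ℝ} (hδ : 0 < δ) :
    ∃ U : Fin (coverNumber δ X) → Set ℝ,
      (∀ i, Metric.ediam (U i) ≤ ENNReal.ofReal δ) ∧ X ⊆ ⋃ i, U i := by
  obtain ⟨P, -, -, hP⟩ := exists_separated_net hX (half_pos hδ)
  have h := exists_cover_of_net hP
  rw [mul_div_cancel₀ δ two_ne_zero] at h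
  exact Nat.sInf_mem ⟨_, h⟩

theorem card_le_coverNumber {X : Set ℝ} (hX : X ⊆ Set.Icc 0 1) {δ : ℝ} (hδ : 0 < δ)
    {ι : Type*} (W : Finset ι) (x : ι → ℝ) (hx : ∀ e ∈ W, x e ∈ X)
    (hsep : ∀ e ∈ W, ∀ e' ∈ W, e ≠ e' → δ < |x e - x e'|) : W.card ≤ coverNumber δ X := by
  obtain ⟨U, hU, hcov⟩ := exists_optimal_cover hX hδ
  have h : ∀ e ∈ W, ∃ i, x e ∈ U i := fun e he => Set.mem_iUnion.1 (hcov (hx e he))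
  choose i hi using h
  have hinj : Function.Injective (fun e : W => i e e.2) := by
    intro e e' he
    by_contra hne
    have h1 := hi e e.2
    have h2 := hi e' e'.2
    rw [← show i e e.2 = i e' e'.2 from he] at h2
    have h3 := (Metric.edist_le_ediam_of_mem h1 h2).trans (hU _)
    rw [edist_le_ofReal hδ.le, Real.dist_eq] at h3
    exact absurd (hsep e e.2 e' e'.2 fun h => hne (Subtype.ext h)) (not_lt.2 h3)
  simpa using Fintype.card_le_of_injective _ hinj

namespace RIFS

section Packing

variable {R : RIFS}

/-! ### Separated families of words -/

/-- There are at least `exp t` words of length `k` in the coding of `ω` that turn the axis `c` into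
`c'`, whose images have projections to the axis `c` of length at least `exp (-l)`, at mutual
distances at least `exp (-l)`. -/
def SeparatedWords (ω : R.Coding) (c : Fin 2) (k : ℕ) (t l : ℝ) (c' : Fin 2) : Prop :=
  ∃ W : Finset R.Word,
    (∀ e ∈ W, e.length = k ∧ Codes e ω ∧ axis e c = c' ∧ Real.exp (-l) ≤ ratio e c) ∧
    (∀ e ∈ W, ∀ e' ∈ W, e ≠ e' → ∀ z ∈ unitSquare, ∀ z' ∈ unitSquare,
      Real.exp (-l) ≤ |wordMap e z c - wordMap e' z' c|) ∧
    Real.exp t ≤ W.card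

theorem SeparatedWords.congr {ω ω' : R.Coding} {c : Fin 2} {k : ℕ} {t l : ℝ} {c' : Fin 2}
    (hω : ∀ i < k, ω i = ω' i) (h : SeparatedWords ω c k t l c') :
    SeparatedWords ω' c k t l c' := by
  obtain ⟨W, h1, h2, h3⟩ := h
  refine ⟨W, fun e he => ?_, h2, h3⟩
  obtain ⟨g1, g2, g3⟩ := h1 e he
  exact ⟨g1, codes_congr (fun i hi => hω i (g1 ▸ hi)) g2, g3⟩

theorem SeparatedWords.exists_word {ω : R.Coding} {c : Fin 2} {k : ℕ} {t l : ℝ} {c' : Fin 2}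
    (h : SeparatedWords ω c k t l c') :
    ∃ e : R.Word, e.length = k ∧ Real.exp (-l) ≤ ratio e c := by
  obtain ⟨W, h1, -, h3⟩ := h
  have : 0 < W.card := by exact_mod_cast (Real.exp_pos t).trans_le h3
  obtain ⟨e, he⟩ := Finset.card_pos.1 this
  exact ⟨e, (h1 e he).1, (h1 e he).2.2.2⟩

theorem SeparatedWords.rate_mul_le {ω : R.Coding} {c : Fin 2} {k : ℕ} {t l : ℝ} {c' : Fin 2}
    (h : SeparatedWords ω c k t l c') : -Real.log R.hi * k ≤ l := by
  obtain ⟨e, h1, h2⟩ := h.exists_word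
  have h3 := Real.log_le_log (Real.exp_pos _) (h2.trans (ratio_le_hi_pow e c))
  rw [Real.log_exp, Real.log_pow, h1] at h3
  linarith

theorem neg_log_hi_pos : 0 < -Real.log R.hi :=
  neg_pos.2 (Real.log_neg R.hi_pos R.hi_lt_one)

theorem SeparatedWords.nonneg {ω : R.Coding} {c : Fin 2} {k : ℕ} {t l : ℝ} {c' : Fin 2}
    (h : SeparatedWords ω c k t l c') : 0 ≤ l :=
  (mul_nonneg neg_log_hi_pos.le (Nat.cast_nonneg k)).trans h.rate_mul_le

theorem SeparatedWords.refl (ω : R.Coding) (c : Fin 2) : SeparatedWords ω c 0 0 0 c := by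
  refine ⟨{[]}, ?_, ?_, by simp⟩
  · intro e he
    rw [Finset.mem_singleton.1 he]
    exact ⟨rfl, trivial, rfl, by simp [ratio]⟩
  · intro e he e' he' hne
    exact absurd ((Finset.mem_singleton.1 he).trans (Finset.mem_singleton.1 he').symm) hne

theorem SeparatedWords.single (ω : R.Coding) (c : Fin 2) (j : Fin (R.numMaps (ω 0))) :
    SeparatedWords ω c 1 0 (-Real.log R.lo) ((R.map (ω 0) j).perm c) := by
  refine ⟨{[⟨ω 0, j⟩]}, ?_, ?_, by simp⟩
  · intro e he
    rw [Finset.mem_singleton.1 he]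
    refine ⟨rfl, ⟨rfl, trivial⟩, rfl, ?_⟩
    rw [neg_neg, Real.exp_log R.lo_pos, ratio, ratio, mul_one]
    exact lo_le_scale ⟨ω 0, j⟩ c
  · intro e he e' he' hne
    exact absurd ((Finset.mem_singleton.1 he).trans (Finset.mem_singleton.1 he').symm) hne

-- For distinct prefixes the separation of the first family survives, because the suffixes map the
-- square into itself. For a common prefix the separation of the second family, measured along the
-- axis `c'` to which the prefix turns `c`, is contracted by at most `exp (-l)`. Equal lengths make
-- the concatenations distinct.
open Classical in
theorem SeparatedWords.trans {ω : R.Coding} {c : Fin 2} {k : ℕ} {t l : ℝ} {c' : Fin 2}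
    {k' : ℕ} {t' l' : ℝ} {c'' : Fin 2} (h : SeparatedWords ω c k t l c')
    (h' : SeparatedWords (shift k ω) c' k' t' l' c'') :
    SeparatedWords ω c (k + k') (t + t') (l + l') c'' := by
  have hl' := h'.nonneg
  obtain ⟨W, h1, h2, h3⟩ := h
  obtain ⟨W', h1', h2', h3'⟩ := h'
  have hexp : Real.exp (-(l + l')) = Real.exp (-l) * Real.exp (-l') := by
    rw [← Real.exp_add]
    ring_nf
  have hle : Real.exp (-(l + l')) ≤ Real.exp (-l) := Real.exp_le_exp.2 (by linarith)
  have hinj : Set.InjOn (fun x : R.Word × R.Word => x.1 ++ x.2) (W ×ˢ W' : Finset _) := by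
    rintro ⟨u, v⟩ hu ⟨u', v'⟩ hu' he
    simp only [Finset.coe_product, Set.mem_prod, Finset.mem_coe] at hu hu'
    have hlen : u.length = u'.length := (h1 u hu.1).1.trans (h1 u' hu'.1).1.symm
    obtain ⟨rfl, rfl⟩ := List.append_inj he hlen
    rfl
  refine ⟨(W ×ˢ W').image fun x => x.1 ++ x.2, ?_, ?_, ?_⟩
  · intro e he
    obtain ⟨⟨u, v⟩, huv, rfl⟩ := Finset.mem_image.1 he
    obtain ⟨hu, hv⟩ := Finset.mem_product.1 huv
    obtain ⟨a1, a2, a3, a4⟩ := h1 u hu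
    obtain ⟨b1, b2, b3, b4⟩ := h1' v hv
    refine ⟨by simp [a1, b1], (codes_append u v ω).2 ⟨a2, by rwa [a1]⟩,
      by rw [axis_append, a3, b3], ?_⟩
    rw [ratio_append, a3, hexp]
    exact mul_le_mul a4 b4 (Real.exp_pos _).le (ratio_pos _ _).le
  · intro e he e' he' hne z hz z' hz'
    obtain ⟨⟨u, v⟩, huv, rfl⟩ := Finset.mem_image.1 he
    obtain ⟨hu, hv⟩ := Finset.mem_product.1 huv
    obtain ⟨⟨u', v'⟩, huv', rfl⟩ := Finset.mem_image.1 he'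
    obtain ⟨hu', hv'⟩ := Finset.mem_product.1 huv'
    simp only [wordMap_append]
    by_cases huu : u = u'
    · subst huu
      have hvv : v ≠ v' := fun h => hne (by rw [h])
      rw [abs_wordMap_sub, (h1 u hu).2.2.1, hexp]
      exact mul_le_mul (h1 u hu).2.2.2 (h2' v hv v' hv' hvv z hz z' hz') (Real.exp_pos _).le
        (ratio_pos _ _).le
    · exact hle.trans (h2 u hu u' hu' huu _ (wordMap_mem v hz) _ (wordMap_mem v' hz'))
  · rw [Finset.card_image_of_injOn hinj, Finset.card_product, Real.exp_add]
    push_cast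
    exact mul_le_mul h3 h3' (Real.exp_pos _).le (Nat.cast_nonneg _)

/-- The projection of the carpet to a coordinate axis. -/
def shadow (ω : R.Coding) (c : Fin 2) : Set ℝ := (fun z : Plane => z c) '' R.carpet ω

theorem shadow_subset (ω : R.Coding) (c : Fin 2) : shadow ω c ⊆ Set.Icc 0 1 := by
  rintro _ ⟨z, hz, rfl⟩
  exact carpet_subset ω hz c

/-- Every image in the family contains a carpet point, and points from different images are too far
apart to share a covering set. -/
theorem SeparatedWords.exp_le_coverNumber (hone : ∀ i, 1 ≤ R.numMaps i) {ω : R.Coding} {c : Fin 2}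
    {k : ℕ} {t l : ℝ} {c' : Fin 2} (h : SeparatedWords ω c k t l c') {δ : ℝ} (hδ : 0 < δ)
    (hδl : δ < Real.exp (-l)) : Real.exp t ≤ coverNumber δ (shadow ω c) := by
  obtain ⟨W, h1, h2, h3⟩ := h
  have hy : ∀ e : R.Word, ∃ y ∈ unitSquare, e ∈ W → wordMap e y ∈ R.carpet ω := by
    intro e
    by_cases he : e ∈ W
    · obtain ⟨y, hy, hc⟩ := exists_wordMap_mem_carpet hone (h1 e he).2.1
      exact ⟨y, hy, fun _ => hc⟩
    · exact ⟨_, const_mem_unitSquare (x := 0) ⟨le_rfl, zero_le_one⟩, fun h => absurd h he⟩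
  choose y hy hc using hy
  refine h3.trans ?_
  exact_mod_cast card_le_coverNumber (shadow_subset ω c) hδ W (fun e => wordMap e (y e) c)
    (fun e he => ⟨_, hc e he, rfl⟩)
    (fun e he e' he' hne => hδl.trans_le (h2 e he e' he' hne _ (hy e) _ (hy e')))

/-- Take the shortest prefix of a long word at `z` whose ratio along `c` is at most `ρ`; its last
letter contracts by at least the factor `lo`, so the ratio cannot fall below `lo * ρ`. -/
theorem exists_word_at_scale {ω : R.Coding} {z : Plane} (hz : z ∈ R.carpet ω) (c : Fin 2) {ρ : ℝ}
    (hρ : ρ < 1) {L : ℕ} (hL : R.hi ^ L ≤ ρ) :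
    ∃ e : R.Word, Codes e ω ∧ 1 ≤ e.length ∧ e.length ≤ L ∧ R.lo * ρ ≤ ratio e c ∧
      ratio e c ≤ ρ ∧ z ∈ R.wordImage e unitSquare := by
  have hL1 : 1 ≤ L := by
    rcases Nat.eq_zero_or_pos L with rfl | h
    · rw [pow_zero] at hL
      linarith
    · exact h
  obtain ⟨e, rfl, he, hze⟩ := mem_carpet.1 hz L hL1
  have hex : ∃ m, ratio (e.take m) c ≤ ρ :=
    ⟨e.length, by rw [List.take_length]; exact (ratio_le_hi_pow e c).trans hL⟩
  classical
  set m := Nat.find hex with hm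
  have hmle : m ≤ e.length :=
    Nat.find_min' hex (by rw [List.take_length]; exact (ratio_le_hi_pow e c).trans hL)
  have hm1 : 1 ≤ m := by
    rcases Nat.eq_zero_or_pos m with h | h
    · have h2 := Nat.find_spec hex
      rw [← hm, h, List.take_zero] at h2
      simp only [ratio] at h2
      linarith
    · exact h
  have hlen : (e.take m).length = m := List.length_take_of_le hmle
  have hsplit := List.take_append_drop m e
  refine ⟨e.take m, ?_, by omega, by omega, ?_, Nat.find_spec hex, ?_⟩
  · rw [← hsplit, codes_append] at he
    exact he.1
  · obtain ⟨n, hn⟩ : ∃ n, m = n + 1 := ⟨m - 1, by omega⟩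
    have hmin : ρ < ratio (e.take n) c := not_le.1 (Nat.find_min hex (by omega))
    rw [hn, List.take_succ_eq_append_getElem (by omega), ratio_append, mul_comm]
    refine mul_le_mul hmin.le ?_ R.lo_pos.le (ratio_pos _ _).le
    rw [ratio, ratio, mul_one]
    exact lo_le_scale _ _
  · refine wordImage_append_subset (e.take m) (e.drop m) ?_
    rwa [hsplit]

theorem abs_sub_le_of_mem_wordImage {e : R.Word} {z y : Plane}
    (hz : z ∈ R.wordImage e unitSquare) (hy : y ∈ unitSquare) (c : Fin 2) :
    |wordMap e y c - z c| ≤ ratio e c := by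
  rw [wordImage_eq] at hz
  obtain ⟨x, hx, rfl⟩ := hz
  rw [abs_wordMap_sub]
  refine mul_le_of_le_one_right (ratio_pos e c).le ?_
  have h1 := hx (axis e c)
  have h2 := hy (axis e c)
  rw [abs_le]
  constructor <;> linarith [h1.1, h1.2, h2.1, h2.2]

/-- A separated set in the projection of the carpet yields a separated family of words of equal
length, at the cost of a factor that is logarithmic in the scale. -/
theorem exists_separatedWords {ω : R.Coding} {c : Fin 2} {δ : ℝ} (hδ : 0 < δ) (hδ1 : δ < 1)
    {L : ℕ} (hL : R.hi ^ L ≤ δ / 3) {P : Finset ℝ} (hP : P.Nonempty)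
    (hPX : (P : Set ℝ) ⊆ shadow ω c) (hsep : ∀ x ∈ P, ∀ y ∈ P, x ≠ y → δ ≤ |x - y|) :
    ∃ k c', 1 ≤ k ∧ SeparatedWords ω c k (Real.log (P.card / (2 * (L + 1))))
      (-Real.log (R.lo * (δ / 3))) c' := by
  classical
  -- Each image stays within `δ / 3` of its point, so images attached to points at distance `δ` keep
  -- distance `δ / 3`.
  have hex : ∀ x : ℝ, ∃ e : R.Word, x ∈ P → Codes e ω ∧ 1 ≤ e.length ∧ e.length ≤ L ∧
      R.lo * (δ / 3) ≤ ratio e c ∧ ratio e c ≤ δ / 3 ∧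
      ∀ y ∈ unitSquare, |wordMap e y c - x| ≤ δ / 3 := by
    intro x
    by_cases hx : x ∈ P
    · obtain ⟨z, hz, rfl⟩ := hPX hx
      obtain ⟨e, h1, h2, h3, h4, h5, h6⟩ := exists_word_at_scale hz c (by linarith) hL
      exact ⟨e, fun _ => ⟨h1, h2, h3, h4, h5, fun y hy =>
        (abs_sub_le_of_mem_wordImage h6 hy c).trans h5⟩⟩
    · exact ⟨[], fun h => absurd h hx⟩
  choose w hw using hex
  have hmaps : ∀ x ∈ P, ((w x).length, axis (w x) c) ∈
      Finset.range (L + 1) ×ˢ (Finset.univ : Finset (Fin 2)) := fun x hx =>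
    Finset.mem_product.2
      ⟨Finset.mem_range.2 (Nat.lt_succ_of_le (hw x hx).2.2.1), Finset.mem_univ _⟩
  have hcard : (P.card : ℝ) / (2 * (L + 1)) > 0 := by
    have : (0 : ℝ) < P.card := by exact_mod_cast Finset.card_pos.2 hP
    positivity
  -- Pigeonhole over `L + 1` lengths and 2 axes; this is the logarithmic loss.
  obtain ⟨⟨k, c'⟩, -, hfib⟩ := Finset.exists_le_card_fiber_of_nsmul_le_card_of_maps_to hmaps
    ⟨(0, 0), by simp⟩ (b := (P.card : ℝ) / (2 * (L + 1))) (by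
      rw [Finset.card_product, Finset.card_range, Finset.card_univ, Fintype.card_fin,
        nsmul_eq_mul]
      push_cast
      rw [mul_comm (L + 1 : ℝ) 2, mul_div_cancel₀]
      positivity)
  set Q := P.filter fun x => ((w x).length, axis (w x) c) = (k, c') with hQ
  have hQm : ∀ x ∈ Q, x ∈ P ∧ (w x).length = k ∧ axis (w x) c = c' := by
    intro x hx
    obtain ⟨h1, h2⟩ := Finset.mem_filter.1 hx
    exact ⟨h1, (Prod.ext_iff.1 h2).1, (Prod.ext_iff.1 h2).2⟩
  have hQne : Q.Nonempty := by
    rw [← Finset.card_pos]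
    exact_mod_cast hcard.trans_le hfib
  have hfar : ∀ x ∈ Q, ∀ x' ∈ Q, x ≠ x' → ∀ z ∈ unitSquare, ∀ z' ∈ unitSquare,
      δ / 3 ≤ |wordMap (w x) z c - wordMap (w x') z' c| := by
    intro x hx x' hx' hne z hz z' hz'
    have h1 := hsep x (hQm x hx).1 x' (hQm x' hx').1 hne
    have h2 := (hw x (hQm x hx).1).2.2.2.2.2 z hz
    have h3 := (hw x' (hQm x' hx').1).2.2.2.2.2 z' hz'
    have h4 := abs_sub_le x (wordMap (w x) z c) x'
    have h5 := abs_sub_le (wordMap (w x) z c) (wordMap (w x') z' c) x'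
    rw [abs_sub_comm x (wordMap (w x) z c)] at h4
    linarith
  have hinj : Set.InjOn w Q := by
    intro x hx x' hx' he
    by_contra hne
    have h0 := const_mem_unitSquare (x := 0) ⟨le_rfl, zero_le_one⟩
    have := hfar x hx x' hx' hne _ h0 _ h0
    rw [he, sub_self, abs_zero] at this
    linarith
  have hlo : Real.exp (- -Real.log (R.lo * (δ / 3))) = R.lo * (δ / 3) := by
    rw [neg_neg, Real.exp_log (mul_pos R.lo_pos (by linarith))]
  have hlo' : R.lo * (δ / 3) ≤ δ / 3 :=
    mul_le_of_le_one_left (by linarith) R.lo_lt_one.le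
  refine ⟨k, c', ?_, Q.image w, ?_, ?_, ?_⟩
  · obtain ⟨x, hx⟩ := hQne
    rw [← (hQm x hx).2.1]
    exact (hw x (hQm x hx).1).2.1
  · intro e he
    obtain ⟨x, hx, rfl⟩ := Finset.mem_image.1 he
    have h := hw x (hQm x hx).1
    exact ⟨(hQm x hx).2.1, h.1, (hQm x hx).2.2, hlo.trans_le h.2.2.2.1⟩
  · intro e he e' he' hne z hz z' hz'
    obtain ⟨x, hx, rfl⟩ := Finset.mem_image.1 he
    obtain ⟨x', hx', rfl⟩ := Finset.mem_image.1 he'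
    rw [hlo]
    exact hlo'.trans (hfar x hx x' hx' (fun h => hne (by rw [h])) z hz z' hz')
  · rw [Real.exp_log hcard, Finset.card_image_of_injOn hinj]
    exact hfib

end Packing

section Dimensions

variable {R : RIFS}

/-! ### Box dimensions of the projections -/

theorem tendsto_neg_log_nhdsGT_zero :
    Tendsto (fun δ : ℝ => -Real.log δ) (𝓝[>] 0) atTop :=
  tendsto_neg_atBot_atTop.comp Real.tendsto_log_nhdsGT_zero

theorem lowerBoxDim_nonneg (X : Set ℝ) : 0 ≤ lowerBoxDim X := by
  refine le_liminf_of_le (by isBoundedDefault) ?_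
  filter_upwards [Ioo_mem_nhdsGT (zero_lt_one (α := ℝ))] with δ hδ
  rw [← EReal.coe_zero, EReal.coe_le_coe_iff]
  exact div_nonneg (Real.log_natCast_nonneg _) (neg_nonneg.2 (Real.log_nonpos hδ.1.le hδ.2.le))

/-- A walk to length just below `-log δ` yields enough pieces separated by more than `δ`; constants
are negligible against `-log δ`. -/
theorem le_lowerBoxDim (hone : ∀ i, 1 ≤ R.numMaps i) {ω : R.Coding} {c : Fin 2} {s κ : ℝ}
    (hs : 0 ≤ s)
    (h : ∀ h : ℝ, 0 ≤ h → ∃ k t l c', SeparatedWords ω c k t l c' ∧ l ≤ h ∧ h - κ ≤ l ∧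
      s * l - κ ≤ t) {s' : ℝ} (hs' : s' < s) : (s' : EReal) ≤ lowerBoxDim (shadow ω c) := by
  refine le_liminf_of_le (by isBoundedDefault) ?_
  set C : ℝ := s * (1 + κ) + κ with hC
  have hbig := tendsto_neg_log_nhdsGT_zero.eventually_gt_atTop (max 1 (C / (s - s')))
  filter_upwards [hbig, self_mem_nhdsWithin] with δ hδ hδ0
  have hδ0' : 0 < δ := hδ0
  have h1 : 1 < -Real.log δ := (le_max_left _ _).trans_lt hδ
  have h2 : C / (s - s') < -Real.log δ := (le_max_right _ _).trans_lt hδ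
  rw [div_lt_iff₀ (sub_pos.2 hs')] at h2
  rw [EReal.coe_le_coe_iff, le_div_iff₀ (by linarith)]
  -- The `- 1` gives the strict inequality `δ < exp (-l)`.
  obtain ⟨k, t, l, c', g1, g2, g3, g4⟩ := h (-Real.log δ - 1) (by linarith)
  have hlt : δ < Real.exp (-l) := by
    rw [← Real.log_lt_iff_lt_exp hδ0']
    linarith
  have hN := Real.log_le_log (Real.exp_pos t) (g1.exp_le_coverNumber hone hδ0' hlt)
  rw [Real.log_exp] at hN
  have := mul_le_mul_of_nonneg_left g3 hs
  linarith

theorem eventually_log_linear_le (a b : ℝ) (ha : 0 < a) {ε : ℝ} (hε : 0 < ε) :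
    ∀ᶠ x : ℝ in atTop, Real.log (a * x + b) ≤ ε * x := by
  have h1 : ∀ᶠ x : ℝ in atTop, ‖Real.log x‖ ≤ ε / 2 * ‖x‖ :=
    Real.isLittleO_log_id_atTop.def (half_pos hε)
  filter_upwards [h1, eventually_ge_atTop 1, eventually_ge_atTop (2 * Real.log (a + |b|) / ε),
    eventually_gt_atTop (-b / a)] with x h1 h2 h3 h4
  have hx : 0 < x := by linarith
  have hpos : 0 < a * x + b := by
    rw [div_lt_iff₀ ha] at h4
    linarith
  have hle : a * x + b ≤ (a + |b|) * x := by
    have := mul_le_mul_of_nonneg_left h2 (abs_nonneg b)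
    have := le_abs_self b
    linarith
  have h5 := Real.log_le_log hpos hle
  rw [Real.log_mul (by positivity) hx.ne'] at h5
  rw [Real.norm_eq_abs, Real.norm_eq_abs, abs_of_pos hx] at h1
  have h6 := le_abs_self (Real.log x)
  rw [div_le_iff₀ hε] at h3
  linarith

/-- A separated `δ / 2`-net has at least `coverNumber δ` points and produces separated words of
length parameter `-log δ + log (6 / lo)`. Half of the gap `s' - s` absorbs the pigeonhole loss, of
order `log (-log δ)`, and half absorbs the constants. -/
theorem upperBoxDim_le (hone : ∀ i, 1 ≤ R.numMaps i) {ω : R.Coding} {c : Fin 2} {s K : ℝ}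
    (h : ∀ k t l c', 1 ≤ k → SeparatedWords ω c k t l c' → t ≤ s * l + K) {s' : ℝ}
    (hs' : s < s') : upperBoxDim (shadow ω c) ≤ (s' : EReal) := by
  refine limsup_le_of_le (by isBoundedDefault) ?_
  have hη : 0 < -Real.log R.hi := neg_log_hi_pos
  set η : ℝ := -Real.log R.hi with hηdef
  set C : ℝ := s * Real.log (6 / R.lo) + K with hC
  have hε : 0 < (s' - s) / 2 := half_pos (sub_pos.2 hs')
  have hlog := tendsto_neg_log_nhdsGT_zero.eventually
    (eventually_log_linear_le (2 / η) (2 * (Real.log 6 / η + 2)) (by positivity) hε)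
  have hbig := tendsto_neg_log_nhdsGT_zero.eventually_gt_atTop (max 0 (C / ((s' - s) / 2)))
  filter_upwards [hlog, hbig, Ioo_mem_nhdsGT (zero_lt_one (α := ℝ))] with δ hlog hbig ⟨hδ0, hδ1⟩
  have h1 : 0 < -Real.log δ := (le_max_left _ _).trans_lt hbig
  have h2 : C / ((s' - s) / 2) < -Real.log δ := (le_max_right _ _).trans_lt hbig
  rw [div_lt_iff₀ hε] at h2
  rw [EReal.coe_le_coe_iff, div_le_iff₀ h1]
  obtain ⟨P, hPX, hsep, hnet⟩ := exists_separated_net (shadow_subset ω c) (half_pos hδ0)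
  have hPne : P.Nonempty := by
    obtain ⟨z, hz⟩ := carpet_nonempty hone ω
    obtain ⟨y, hy, -⟩ := hnet (z c) ⟨z, hz, rfl⟩
    exact ⟨y, hy⟩
  have hN : coverNumber δ (shadow ω c) ≤ P.card := by
    have := coverNumber_le_card hnet
    rwa [mul_div_cancel₀ δ two_ne_zero] at this
  have hlogN : Real.log (coverNumber δ (shadow ω c)) ≤ Real.log P.card := by
    rcases Nat.eq_zero_or_pos (coverNumber δ (shadow ω c)) with h0 | h0
    · rw [h0, Nat.cast_zero, Real.log_zero]
      exact Real.log_natCast_nonneg _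
    · exact Real.log_le_log (by exact_mod_cast h0) (by exact_mod_cast hN)
  set L : ℕ := ⌈(-Real.log δ + Real.log 6) / η⌉₊ with hLdef
  have hlog6 : Real.log (δ / 2 / 3) = Real.log δ - Real.log 6 := by
    rw [div_div, Real.log_div hδ0.ne' (by norm_num)]
    norm_num
  have hL : R.hi ^ L ≤ δ / 2 / 3 := by
    rw [← Real.log_le_log_iff (pow_pos R.hi_pos _) (by positivity), Real.log_pow, hlog6]
    have := Nat.le_ceil ((-Real.log δ + Real.log 6) / η)
    rw [div_le_iff₀ hη, ← hLdef, hηdef] at this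
    linarith
  have hLle : (L : ℝ) ≤ (-Real.log δ + Real.log 6) / η + 1 := by
    refine (Nat.ceil_lt_add_one (div_nonneg ?_ hη.le)).le
    have := Real.log_pos (show (1 : ℝ) < 6 by norm_num)
    linarith
  obtain ⟨k, c', hk, hW⟩ := exists_separatedWords (half_pos hδ0) (by linarith) hL hPne hPX hsep
  have hmain := h _ _ _ _ hk hW
  have hcard : (P.card : ℝ) ≠ 0 := by exact_mod_cast (Finset.card_pos.2 hPne).ne'
  have hL0 : (0 : ℝ) < 2 * (L + 1) := by positivity
  rw [Real.log_div hcard hL0.ne', Real.log_mul R.lo_pos.ne' (by positivity), hlog6] at hmain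
  have hlo6 : Real.log (6 / R.lo) = Real.log 6 - Real.log R.lo :=
    Real.log_div (by norm_num) R.lo_pos.ne'
  have hLlog : Real.log (2 * (L + 1)) ≤ (s' - s) / 2 * -Real.log δ := by
    refine (Real.log_le_log hL0 ?_).trans hlog
    calc 2 * ((L : ℝ) + 1) ≤ 2 * ((-Real.log δ + Real.log 6) / η + 1 + 1) := by linarith
      _ = 2 / η * -Real.log δ + 2 * (Real.log 6 / η + 2) := by ring
  rw [hC, hlo6] at h2
  linarith

theorem box_dimensions_eq (hone : ∀ i, 1 ≤ R.numMaps i) {ω : R.Coding} {c : Fin 2} {β : EReal}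
    (h : ∀ s : ℝ,
      ((s : EReal) < β → ∃ κ : ℝ, ∀ h : ℝ, 0 ≤ h → ∃ k t l c', SeparatedWords ω c k t l c' ∧
        l ≤ h ∧ h - κ ≤ l ∧ s * l - κ ≤ t) ∧
      (β < s → ∃ K : ℝ, ∀ k t l c', 1 ≤ k → SeparatedWords ω c k t l c' → t ≤ s * l + K)) :
    upperBoxDim (shadow ω c) = β ∧ lowerBoxDim (shadow ω c) = β := by
  have hle : lowerBoxDim (shadow ω c) ≤ upperBoxDim (shadow ω c) :=
    liminf_le_limsup (by isBoundedDefault) (by isBoundedDefault)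
  have hup : upperBoxDim (shadow ω c) ≤ β := by
    refine le_of_forall_gt_imp_ge_of_dense fun a ha => ?_
    obtain ⟨s', h1, h2⟩ := EReal.lt_iff_exists_real_btwn.1 ha
    obtain ⟨s, h3, h4⟩ := EReal.lt_iff_exists_real_btwn.1 h1
    obtain ⟨K, hK⟩ := (h s).2 h3
    exact (upperBoxDim_le hone hK (EReal.coe_lt_coe_iff.1 h4)).trans h2.le
  have hlow : β ≤ lowerBoxDim (shadow ω c) := by
    refine le_of_forall_lt_imp_le_of_dense fun a ha => ?_
    obtain ⟨s', h1, h2⟩ := EReal.lt_iff_exists_real_btwn.1 ha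
    -- `le_lowerBoxDim` needs a nonnegative slope; negative bounds are trivial.
    rcases lt_or_ge s' 0 with h0 | h0
    · refine (h1.le.trans ?_).trans (lowerBoxDim_nonneg _)
      exact_mod_cast h0.le
    obtain ⟨s, h3, h4⟩ := EReal.lt_iff_exists_real_btwn.1 h2
    have h5 := EReal.coe_lt_coe_iff.1 h3
    obtain ⟨κ, hκ⟩ := (h s).1 h4
    exact h1.le.trans (le_lowerBoxDim hone (h0.trans h5.le) hκ h5)
  exact ⟨le_antisymm hup (hlow.trans hle), le_antisymm (hle.trans hup) hlow⟩

/-- The step process of separated words in which both axes are visited. -/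
def swappingProcess (sel : ∀ i, Fin (R.numMaps i))
    (hsel : ∃ i, (R.map i (sel i)).perm = Equiv.swap 0 1) : StepProcess R (Fin 2) where
  S := SeparatedWords
  next i c := (R.map i (sel i)).perm c
  loss := 0
  cost := -Real.log R.lo
  rate := -Real.log R.hi
  rate_pos := neg_log_hi_pos
  loss_nonneg := le_rfl
  cost_nonneg := neg_nonneg.2 (Real.log_nonpos R.lo_pos.le R.lo_lt_one.le)
  determined _ _ _ _ _ _ _ h hS := hS.congr h
  refl := SeparatedWords.refl
  single ω c := by
    rw [neg_zero]
    exact SeparatedWords.single ω c (sel (ω 0))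
  trans _ _ _ _ _ _ _ _ _ _ h h' := h.trans h'
  length_le _ _ _ _ _ _ h := h.rate_mul_le
  connected c c' := by
    by_cases hc : c = c'
    · exact Or.inl hc
    · obtain ⟨i, hi⟩ := hsel
      refine Or.inr ⟨i, ?_⟩
      rw [hi]
      fin_cases c <;> fin_cases c' <;> simp_all

/-- The step process of separated words along one axis. -/
def fixedProcess (sel : ∀ i, Fin (R.numMaps i)) (hperm : ∀ i j, (R.map i j).perm = 1)
    (c : Fin 2) : StepProcess R Unit where
  S ω _ k t l _ := SeparatedWords ω c k t l c
  next _ u := u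
  loss := 0
  cost := -Real.log R.lo
  rate := -Real.log R.hi
  rate_pos := neg_log_hi_pos
  loss_nonneg := le_rfl
  cost_nonneg := neg_nonneg.2 (Real.log_nonpos R.lo_pos.le R.lo_lt_one.le)
  determined _ _ _ _ _ _ _ h hS := hS.congr h
  refl ω _ := SeparatedWords.refl ω c
  single ω _ := by
    have := SeparatedWords.single ω c (sel (ω 0))
    rwa [hperm, Equiv.Perm.one_apply, ← neg_zero] at this
  trans _ _ _ _ _ _ _ _ _ _ h h' := h.trans h'
  length_le _ _ _ _ _ _ h := h.rate_mul_le
  connected _ _ := Or.inl rfl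

theorem perm_eq_one_or_swap (f : BoxMap) : f.perm = 1 ∨ f.perm = Equiv.swap 0 1 := by
  unfold BoxMap.perm
  split_ifs
  exacts [Or.inr rfl, Or.inl rfl]

theorem axis_eq_one (hperm : ∀ i j, (R.map i j).perm = 1) (e : R.Word) : axis e = 1 := by
  induction e with
  | nil => rfl
  | cons e w ih =>
    rw [axis, ih, hperm]
    rfl

theorem SeparatedWords.eq_of_perm (hperm : ∀ i j, (R.map i j).perm = 1) {ω : R.Coding}
    {c : Fin 2} {k : ℕ} {t l : ℝ} {c' : Fin 2} (h : SeparatedWords ω c k t l c') : c' = c := by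
  obtain ⟨W, h1, -, h3⟩ := h
  have : 0 < W.card := by exact_mod_cast (Real.exp_pos t).trans_le h3
  obtain ⟨e, he⟩ := Finset.card_pos.1 this
  rw [← (h1 e he).2.2.1, axis_eq_one hperm, Equiv.Perm.one_apply]

/-- The box dimensions of the two projections exist and are constant almost surely; they agree if
some map interchanges the axes. -/
theorem exists_box_dimensions (hone : ∀ i, 1 ≤ R.numMaps i) :
    ∃ β : Fin 2 → EReal, ((∀ i j, (R.map i j).perm = 1) ∨ β 0 = β 1) ∧
      ∀ᵐ ω ∂(R.bernoulli), ∀ c, upperBoxDim (shadow ω c) = β c ∧ lowerBoxDim (shadow ω c) = β c := by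
  classical
  -- Without interchanges the axes evolve separately, each with its own constant. Otherwise one
  -- process has both axes as states, and a single letter connects them.
  by_cases hperm : ∀ i j, (R.map i j).perm = 1
  · have h := fun c => (fixedProcess (fun i => ⟨0, hone i⟩) hperm c).exists_growth_rate
    choose β hβ using h
    refine ⟨β, Or.inl hperm, ?_⟩
    filter_upwards [ae_all_iff.2 hβ] with ω hω c
    refine box_dimensions_eq hone fun s => ⟨fun hs => ?_, fun hs => ?_⟩
    · obtain ⟨κ, hκ⟩ := (hω c () s).1 hs
      refine ⟨κ, fun h hh => ?_⟩
      obtain ⟨k, t, l, _, h1, h2⟩ := hκ h hh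
      exact ⟨k, t, l, c, h1, h2⟩
    · obtain ⟨K, hK⟩ := (hω c () s).2 hs
      refine ⟨K, fun k t l c' hk hS => hK k t l () hk ?_⟩
      obtain rfl := hS.eq_of_perm hperm
      exact hS
  · push Not at hperm
    obtain ⟨i₀, j₀, hij⟩ := hperm
    have hsw := (perm_eq_one_or_swap (R.map i₀ j₀)).resolve_left hij
    obtain ⟨β, hβ⟩ := (swappingProcess
      -- The fallback map of the family `i₀` is chosen to be one that interchanges the axes.
      (Function.update (fun i => ⟨0, hone i⟩) i₀ j₀) ⟨i₀, by simpa using hsw⟩).exists_growth_rate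
    refine ⟨fun _ => β, Or.inr rfl, ?_⟩
    filter_upwards [hβ] with ω hω c
    exact box_dimensions_eq hone (hω c)

end Dimensions

section Pressure

variable {R : RIFS}

/-! ### Sums over levels -/

/-- The sum of a function of words over the `k`-level coding. -/
def levelSum (ω : R.Coding) (k : ℕ) (φ : R.Word → ℝ) : ℝ :=
  ∑ j : R.Level ω k, φ (R.levelWord ω k j)

theorem levelSum_zero (ω : R.Coding) (φ : R.Word → ℝ) : levelSum ω 0 φ = φ [] := by
  rw [levelSum, Fintype.sum_unique]
  rfl

theorem levelSum_succ (ω : R.Coding) (k : ℕ) (φ : R.Word → ℝ) :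
    levelSum ω (k + 1) φ =
      ∑ a : Fin (R.numMaps (ω 0)), levelSum (shift 1 ω) k fun w => φ (⟨ω 0, a⟩ :: w) := by
  rw [levelSum, ← (Fin.consEquiv fun l : Fin (k + 1) => Fin (R.numMaps (ω l))).sum_comp,
    Fintype.sum_prod_type]
  refine Finset.sum_congr rfl fun a _ => Finset.sum_congr rfl fun j _ => ?_
  rw [levelWord_succ]
  rfl

theorem levelSum_add (ω : R.Coding) (k l : ℕ) (φ : R.Word → ℝ) :
    levelSum ω (k + l) φ =
      levelSum ω k fun u => levelSum (shift k ω) l fun v => φ (u ++ v) := by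
  induction k generalizing ω φ with
  | zero =>
    rw [levelSum_zero, Nat.zero_add]
    rfl
  | succ k ih =>
    rw [Nat.add_right_comm, levelSum_succ, levelSum_succ]
    refine Finset.sum_congr rfl fun a _ => ?_
    rw [ih]
    rfl

theorem levelSum_congr {ω ω' : R.Coding} {k : ℕ} (h : ∀ i < k, ω i = ω' i) (φ : R.Word → ℝ) :
    levelSum ω k φ = levelSum ω' k φ := by
  induction k generalizing ω ω' φ with
  | zero => rw [levelSum_zero, levelSum_zero]
  | succ k ih =>
    have hs : ∀ ψ, levelSum (shift 1 ω) k ψ = levelSum (shift 1 ω') k ψ := fun ψ =>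
      ih (fun i hi => h (i + 1) (Nat.succ_lt_succ hi)) ψ
    rw [levelSum_succ, levelSum_succ]
    simp only [hs]
    rw [h 0 (Nat.succ_pos k)]

theorem levelSum_le_levelSum {ω : R.Coding} {k : ℕ} {φ ψ : R.Word → ℝ}
    (h : ∀ e : R.Word, e.length = k → φ e ≤ ψ e) : levelSum ω k φ ≤ levelSum ω k ψ :=
  Finset.sum_le_sum fun j _ => h _ (length_levelWord ω k j)

theorem levelSum_mul_right (ω : R.Coding) (k : ℕ) (φ : R.Word → ℝ) (C : ℝ) :
    (levelSum ω k fun e => φ e * C) = levelSum ω k φ * C :=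
  (Finset.sum_mul _ _ _).symm

theorem levelSum_mul_left (ω : R.Coding) (k : ℕ) (φ : R.Word → ℝ) (C : ℝ) :
    (levelSum ω k fun e => C * φ e) = C * levelSum ω k φ :=
  (Finset.mul_sum _ _ _).symm

theorem levelSum_mul_levelSum (ω : R.Coding) (k l : ℕ) (φ : R.Word → ℝ) :
    levelSum ω k φ * levelSum (shift k ω) l φ =
      levelSum ω k fun u => levelSum (shift k ω) l fun v => φ u * φ v := by
  simp only [levelSum_mul_left, levelSum_mul_right]

theorem levelSum_add_le {φ : R.Word → ℝ} (h : ∀ u v, φ (u ++ v) ≤ φ u * φ v) (ω : R.Coding)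
    (k l : ℕ) : levelSum ω (k + l) φ ≤ levelSum ω k φ * levelSum (shift k ω) l φ := by
  rw [levelSum_add, levelSum_mul_levelSum]
  exact levelSum_le_levelSum fun u _ => levelSum_le_levelSum fun v _ => h u v

theorem le_levelSum_add {φ : R.Word → ℝ} (h : ∀ u v, φ u * φ v ≤ φ (u ++ v)) (ω : R.Coding)
    (k l : ℕ) : levelSum ω k φ * levelSum (shift k ω) l φ ≤ levelSum ω (k + l) φ := by
  rw [levelSum_add, levelSum_mul_levelSum]
  exact levelSum_le_levelSum fun u _ => levelSum_le_levelSum fun v _ => h u v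

theorem le_levelSum (hone : ∀ i, 1 ≤ R.numMaps i) {ω : R.Coding} {k : ℕ} {φ : R.Word → ℝ} {C : ℝ}
    (hC : 0 ≤ C) (h : ∀ e : R.Word, e.length = k → C ≤ φ e) : C ≤ levelSum ω k φ := by
  have h1 : ∀ j, C ≤ φ (R.levelWord ω k j) := fun j => h _ (length_levelWord ω k j)
  exact (h1 fun l => ⟨0, hone (ω l)⟩).trans
    (Finset.single_le_sum (f := fun j => φ (R.levelWord ω k j))
      (fun j _ => hC.trans (h1 j)) (Finset.mem_univ _))

theorem exists_levelSum_le (hone : ∀ i, 1 ≤ R.numMaps i) :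
    ∃ m : ℝ, 1 ≤ m ∧ ∀ (ω : R.Coding) (k : ℕ) (φ : R.Word → ℝ) (C : ℝ), 0 ≤ C →
      (∀ e : R.Word, e.length = k → φ e ≤ C) → levelSum ω k φ ≤ m ^ k * C := by
  obtain ⟨ω₀⟩ : Nonempty R.Coding := nonempty_of_isProbabilityMeasure R.bernoulli
  have hle : ∀ i, R.numMaps i ≤ Finset.univ.sup R.numMaps := fun i =>
    Finset.le_sup (Finset.mem_univ i)
  refine ⟨(Finset.univ.sup R.numMaps : ℕ), ?_, fun ω k φ C hC h => ?_⟩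
  · exact_mod_cast (hone (ω₀ 0)).trans (hle _)
  · calc levelSum ω k φ ≤ ∑ _j : R.Level ω k, C :=
          Finset.sum_le_sum fun j _ => h _ (length_levelWord ω k j)
      _ = (Fintype.card (R.Level ω k) : ℝ) * C := by
          rw [Finset.sum_const, Finset.card_univ, nsmul_eq_mul]
      _ ≤ _ := by
          refine mul_le_mul_of_nonneg_right ?_ hC
          rw [Fintype.card_pi]
          simp only [Fintype.card_fin]
          have := Finset.prod_le_pow_card Finset.univ (fun l : Fin k => R.numMaps (ω l)) _
            fun l _ => hle (ω l)
          rw [Finset.card_univ, Fintype.card_fin] at this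
          exact_mod_cast this

/-! ### The singular value function with fixed dimensions -/

/-- The modified singular value function for prescribed dimensions of the two projections. -/
def singularValue (d : Fin 2 → ℝ) (s : ℝ) (e : R.Word) : ℝ :=
  ratio e 0 ^ (s - d 1) * ratio e 1 ^ (s - d 0) *
    max (ratio e 0) (ratio e 1) ^ (d 0 + d 1 - s)

theorem max_ratio_pos (e : R.Word) : 0 < max (ratio e 0) (ratio e 1) :=
  (ratio_pos e 0).trans_le (le_max_left _ _)

theorem singularValue_pos (d : Fin 2 → ℝ) (s : ℝ) (e : R.Word) : 0 < singularValue d s e :=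
  mul_pos (mul_pos (Real.rpow_pos_of_pos (ratio_pos e 0) _)
    (Real.rpow_pos_of_pos (ratio_pos e 1) _)) (Real.rpow_pos_of_pos (max_ratio_pos e) _)

/-- Along the longer axis `c` the two exponents add up to `d c`. The symmetric form avoids the case
distinction and isolates the only factor that is not multiplicative, the power of the maximum. -/
theorem longSide_rpow_mul (d : Fin 2 → ℝ) (s : ℝ) (e : R.Word) :
    R.longSide e ^ d (R.longAxis e) * R.shortSide e ^ (s - d (R.longAxis e)) =
      singularValue d s e := by
  rw [longSide, shortSide, longAxis, singularValue]
  simp only [side_eq]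
  split_ifs with h
  · rw [max_eq_left h, min_eq_right h, mul_right_comm, ← Real.rpow_add (ratio_pos e 0)]
    congr 2
    ring
  · push Not at h
    rw [max_eq_right h.le, min_eq_left h.le, mul_assoc, ← Real.rpow_add (ratio_pos e 1), mul_comm]
    congr 2
    ring

theorem axis_eq_one_or_swap (e : R.Word) : axis e = 1 ∨ axis e = Equiv.swap 0 1 := by
  by_cases h : axis e 0 = 0
  · left
    have h1 : axis e 1 ≠ 0 := fun h' => absurd ((axis e).injective (h'.trans h.symm)) (by decide)
    ext c
    fin_cases c
    · simp [h]
    · simp [Fin.eq_one_of_ne_zero _ h1]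
  · right
    have h0 := Fin.eq_one_of_ne_zero _ h
    have h1 : axis e 1 = 0 := by
      by_contra h'
      exact absurd ((axis e).injective ((Fin.eq_one_of_ne_zero _ h').trans h0.symm)) (by decide)
    ext c
    fin_cases c
    · simp [h0]
    · simp [h1]

/-- A prefix may interchange the roles of the axes in the suffix; then the two exponents must agree,
which is what `hd` provides. -/
theorem rpow_mul_rpow_append {d : Fin 2 → ℝ}
    (hd : (∀ i j, (R.map i j).perm = 1) ∨ d 0 = d 1) (s : ℝ) (u v : R.Word) :
    ratio (u ++ v) 0 ^ (s - d 1) * ratio (u ++ v) 1 ^ (s - d 0) =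
      (ratio u 0 ^ (s - d 1) * ratio u 1 ^ (s - d 0)) *
        (ratio v 0 ^ (s - d 1) * ratio v 1 ^ (s - d 0)) := by
  have h0 := fun (e : R.Word) c => (ratio_pos e c).le
  rw [ratio_append, ratio_append, Real.mul_rpow (h0 _ _) (h0 _ _),
    Real.mul_rpow (h0 _ _) (h0 _ _)]
  rcases hd with hperm | hd
  · rw [axis_eq_one hperm, Equiv.Perm.one_apply, Equiv.Perm.one_apply]
    ring
  · rw [hd]
    rcases axis_eq_one_or_swap u with h | h
    · rw [h, Equiv.Perm.one_apply, Equiv.Perm.one_apply]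
      ring
    · rw [h, Equiv.swap_apply_left, Equiv.swap_apply_right]
      ring

theorem max_ratio_append_le (u v : R.Word) :
    max (ratio (u ++ v) 0) (ratio (u ++ v) 1) ≤
      max (ratio u 0) (ratio u 1) * max (ratio v 0) (ratio v 1) := by
  have h : ∀ (e : R.Word) c, ratio e c ≤ max (ratio e 0) (ratio e 1) := by
    intro e c
    fin_cases c
    exacts [le_max_left _ _, le_max_right _ _]
  refine max_le ?_ ?_ <;> rw [ratio_append] <;>
    exact mul_le_mul (h u _) (h v _) (ratio_pos v _).le (max_ratio_pos u).le

/-- The maximum is submultiplicative and here carries a nonnegative exponent; for a nonpositive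
exponent the inequality reverses. -/
theorem singularValue_append_le {d : Fin 2 → ℝ}
    (hd : (∀ i j, (R.map i j).perm = 1) ∨ d 0 = d 1) {s : ℝ} (hs : s ≤ d 0 + d 1)
    (u v : R.Word) :
    singularValue d s (u ++ v) ≤ singularValue d s u * singularValue d s v := by
  rw [singularValue, singularValue, singularValue, rpow_mul_rpow_append hd,
    mul_mul_mul_comm _ (max (ratio u 0) (ratio u 1) ^ _),
    ← Real.mul_rpow (max_ratio_pos u).le (max_ratio_pos v).le]
  have h := fun (e : R.Word) c p => (Real.rpow_pos_of_pos (ratio_pos e c) p).le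
  refine mul_le_mul_of_nonneg_left ?_
    (mul_nonneg (mul_nonneg (h _ _ _) (h _ _ _)) (mul_nonneg (h _ _ _) (h _ _ _)))
  exact Real.rpow_le_rpow (max_ratio_pos _).le (max_ratio_append_le u v) (by linarith)

theorem le_singularValue_append {d : Fin 2 → ℝ}
    (hd : (∀ i j, (R.map i j).perm = 1) ∨ d 0 = d 1) {s : ℝ} (hs : d 0 + d 1 ≤ s)
    (u v : R.Word) :
    singularValue d s u * singularValue d s v ≤ singularValue d s (u ++ v) := by
  rw [singularValue, singularValue, singularValue, rpow_mul_rpow_append hd,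
    mul_mul_mul_comm _ (max (ratio u 0) (ratio u 1) ^ _),
    ← Real.mul_rpow (max_ratio_pos u).le (max_ratio_pos v).le]
  have h := fun (e : R.Word) c p => (Real.rpow_pos_of_pos (ratio_pos e c) p).le
  refine mul_le_mul_of_nonneg_left ?_
    (mul_nonneg (mul_nonneg (h _ _ _) (h _ _ _)) (mul_nonneg (h _ _ _) (h _ _ _)))
  exact Real.rpow_le_rpow_of_nonpos (max_ratio_pos _) (max_ratio_append_le u v) (by linarith)

theorem abs_log_le {x : ℝ} {k : ℕ} (h1 : R.lo ^ k ≤ x) (h2 : x ≤ 1) :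
    |Real.log x| ≤ -Real.log R.lo * k := by
  have h3 := Real.log_le_log (pow_pos R.lo_pos k) h1
  rw [Real.log_pow] at h3
  rw [abs_of_nonpos (Real.log_nonpos ((pow_pos R.lo_pos k).trans_le h1).le h2)]
  linarith

theorem exists_abs_log_singularValue_le (d : Fin 2 → ℝ) (s : ℝ) :
    ∃ D : ℝ, ∀ e : R.Word, |Real.log (singularValue d s e)| ≤ D * e.length := by
  refine ⟨(|s - d 1| + |s - d 0| + |d 0 + d 1 - s|) * -Real.log R.lo, fun e => ?_⟩
  have hp := fun c p => (Real.rpow_pos_of_pos (ratio_pos e c) p).ne'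
  rw [singularValue, Real.log_mul (mul_ne_zero (hp _ _) (hp _ _))
    (Real.rpow_pos_of_pos (max_ratio_pos e) _).ne', Real.log_mul (hp _ _) (hp _ _),
    Real.log_rpow (ratio_pos _ _), Real.log_rpow (ratio_pos _ _), Real.log_rpow (max_ratio_pos _)]
  have h0 := abs_log_le (lo_pow_le_ratio e 0) (ratio_le_one e 0)
  have h1 := abs_log_le (lo_pow_le_ratio e 1) (ratio_le_one e 1)
  have h2 := abs_log_le ((lo_pow_le_ratio e 0).trans (le_max_left _ (ratio e 1)))
    (max_le (ratio_le_one e 0) (ratio_le_one e 1))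
  refine (abs_add_three _ _ _).trans ?_
  rw [abs_mul, abs_mul, abs_mul]
  have g0 := mul_le_mul_of_nonneg_left h0 (abs_nonneg (s - d 1))
  have g1 := mul_le_mul_of_nonneg_left h1 (abs_nonneg (s - d 0))
  have g2 := mul_le_mul_of_nonneg_left h2 (abs_nonneg (d 0 + d 1 - s))
  linarith

theorem levelSum_singularValue_pos (hone : ∀ i, 1 ≤ R.numMaps i) (ω : R.Coding) (k : ℕ)
    (d : Fin 2 → ℝ) (s : ℝ) : 0 < levelSum ω k (singularValue d s) :=
  Finset.sum_pos (fun _ _ => singularValue_pos d s _)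
    ⟨fun l => ⟨0, hone (ω l)⟩, Finset.mem_univ _⟩

theorem exists_abs_log_levelSum_le (hone : ∀ i, 1 ≤ R.numMaps i) (d : Fin 2 → ℝ) (s : ℝ) :
    ∃ A : ℝ, ∀ (ω : R.Coding) (k : ℕ),
      |Real.log (levelSum ω k (singularValue d s))| ≤ A * k := by
  obtain ⟨D, hD⟩ := exists_abs_log_singularValue_le (R := R) d s
  obtain ⟨m, hm1, hm⟩ := exists_levelSum_le hone
  refine ⟨D + Real.log m, fun ω k => ?_⟩
  have hm0 := Real.log_nonneg hm1
  have hmk := mul_nonneg hm0 (Nat.cast_nonneg (α := ℝ) k)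
  have hmpos : 0 < m := by linarith
  have hlow : Real.exp (-(D * k)) ≤ levelSum ω k (singularValue d s) :=
    le_levelSum hone (Real.exp_pos _).le fun e he => by
      rw [← Real.le_log_iff_exp_le (singularValue_pos d s e), ← he]
      exact neg_le_of_abs_le (hD e)
  have hup : levelSum ω k (singularValue d s) ≤ m ^ k * Real.exp (D * k) :=
    hm ω k _ _ (Real.exp_pos _).le fun e he => by
      rw [← Real.log_le_iff_le_exp (singularValue_pos d s e), ← he]
      exact le_of_abs_le (hD e)
  have h1 := Real.log_le_log (Real.exp_pos _) hlow
  have h2 := Real.log_le_log (levelSum_singularValue_pos hone ω k d s) hup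
  rw [Real.log_exp] at h1
  rw [Real.log_mul (pow_pos hmpos k).ne' (Real.exp_pos _).ne', Real.log_exp, Real.log_pow] at h2
  rw [abs_le, add_mul]
  constructor <;> linarith

/-- The exponential growth rate of the level sums exists almost surely. -/
theorem exists_tendsto_log_levelSum (hone : ∀ i, 1 ≤ R.numMaps i) {d : Fin 2 → ℝ}
    (hd : (∀ i j, (R.map i j).perm = 1) ∨ d 0 = d 1) (s : ℝ) :
    ∃ L : ℝ, ∀ᵐ ω ∂(R.bernoulli),
      Tendsto (fun n : ℕ => Real.log (levelSum ω n (singularValue d s)) / n) atTop (𝓝 L) := by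
  obtain ⟨A, hA⟩ := exists_abs_log_levelSum_le hone d s
  have hpos := fun ω k => levelSum_singularValue_pos hone ω k d s
  rcases le_total s (d 0 + d 1) with hs | hs
  · obtain ⟨L, hL⟩ := exists_tendsto_of_superadditive
      (fun ω k => -Real.log (levelSum ω k (singularValue d s))) A
      (fun ω ω' k h => by rw [levelSum_congr h])
      (fun ω k l => by
        have := Real.log_le_log (hpos ω (k + l))
          (levelSum_add_le (singularValue_append_le hd hs) ω k l)
        rw [Real.log_mul (hpos _ _).ne' (hpos _ _).ne'] at this
        linarith)
      (fun ω k => by rw [abs_neg]; exact hA ω k)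
    refine ⟨-L, ?_⟩
    filter_upwards [hL] with ω hω
    refine hω.neg.congr fun n => ?_
    rw [neg_div, neg_neg]
  · exact exists_tendsto_of_superadditive
      (fun ω k => Real.log (levelSum ω k (singularValue d s))) A
      (fun ω ω' k h => by rw [levelSum_congr h])
      (fun ω k l => by
        have := Real.log_le_log (mul_pos (hpos _ _) (hpos _ _))
          (le_levelSum_add (le_singularValue_append hd hs) ω k l)
        rwa [Real.log_mul (hpos _ _).ne' (hpos _ _).ne'] at this)
      hA

/-- The change of `s` contributes `(ratio e 0 * ratio e 1) ^ δ / max ^ δ`, and the product of the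
two ratios is minimum times maximum. -/
theorem singularValue_add (d : Fin 2 → ℝ) (s δ : ℝ) (e : R.Word) :
    singularValue d (s + δ) e = singularValue d s e * min (ratio e 0) (ratio e 1) ^ δ := by
  have h0 := ratio_pos e 0
  have h1 := ratio_pos e 1
  have hmax := max_ratio_pos e
  have hmin : 0 < min (ratio e 0) (ratio e 1) := lt_min h0 h1
  have hmul : min (ratio e 0) (ratio e 1) ^ δ * max (ratio e 0) (ratio e 1) ^ δ =
      ratio e 0 ^ δ * ratio e 1 ^ δ := by
    rw [← Real.mul_rpow hmin.le hmax.le, min_mul_max, Real.mul_rpow h0.le h1.le]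
  have e0 : s + δ - d 1 = (s - d 1) + δ := by ring
  have e1 : s + δ - d 0 = (s - d 0) + δ := by ring
  have e2 : d 0 + d 1 - s = (d 0 + d 1 - (s + δ)) + δ := by ring
  rw [singularValue, singularValue, e0, e1, e2, Real.rpow_add h0, Real.rpow_add h1,
    Real.rpow_add hmax]
  linear_combination (ratio e 0 ^ (s - d 1) * ratio e 1 ^ (s - d 0) *
    max (ratio e 0) (ratio e 1) ^ (d 0 + d 1 - (s + δ))) * -hmul

/-- The normalised logarithm of the level sum is Lipschitz and uniformly decreasing in `s`. -/
theorem log_levelSum_sub (hone : ∀ i, 1 ≤ R.numMaps i) (d : Fin 2 → ℝ) {s δ : ℝ} (hδ : 0 ≤ δ)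
    (ω : R.Coding) {n : ℕ} (hn : 0 < n) :
    Real.log (levelSum ω n (singularValue d s)) / n + δ * Real.log R.lo ≤
        Real.log (levelSum ω n (singularValue d (s + δ))) / n ∧
      Real.log (levelSum ω n (singularValue d (s + δ))) / n ≤
        Real.log (levelSum ω n (singularValue d s)) / n + δ * Real.log R.hi := by
  have hn' : (0 : ℝ) < n := by exact_mod_cast hn
  have hpos := fun s => levelSum_singularValue_pos hone ω n d s
  have hlo := pow_pos R.lo_pos n
  have hhi := pow_pos R.hi_pos n
  have h1 : levelSum ω n (singularValue d s) * (R.lo ^ n) ^ δ ≤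
      levelSum ω n (singularValue d (s + δ)) := by
    rw [← levelSum_mul_right]
    refine levelSum_le_levelSum fun e he => ?_
    rw [singularValue_add]
    refine mul_le_mul_of_nonneg_left ?_ (singularValue_pos d s e).le
    refine Real.rpow_le_rpow hlo.le (le_min ?_ ?_) hδ <;> rw [← he] <;> exact lo_pow_le_ratio e _
  have h2 : levelSum ω n (singularValue d (s + δ)) ≤
      levelSum ω n (singularValue d s) * (R.hi ^ n) ^ δ := by
    rw [← levelSum_mul_right]
    refine levelSum_le_levelSum fun e he => ?_
    rw [singularValue_add]
    refine mul_le_mul_of_nonneg_left ?_ (singularValue_pos d s e).le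
    refine Real.rpow_le_rpow (lt_min (ratio_pos e 0) (ratio_pos e 1)).le
      ((min_le_left _ _).trans ?_) hδ
    rw [← he]
    exact ratio_le_hi_pow e 0
  have h3 := Real.log_le_log (mul_pos (hpos s) (Real.rpow_pos_of_pos hlo δ)) h1
  have h4 := Real.log_le_log (hpos (s + δ)) h2
  rw [Real.log_mul (hpos s).ne' (Real.rpow_pos_of_pos hlo δ).ne', Real.log_rpow hlo,
    Real.log_pow] at h3
  rw [Real.log_mul (hpos s).ne' (Real.rpow_pos_of_pos hhi δ).ne', Real.log_rpow hhi,
    Real.log_pow] at h4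
  rw [le_div_iff₀ hn', div_le_iff₀ hn', add_mul, add_mul, div_mul_cancel₀ _ hn'.ne']
  constructor <;> linarith

/-- Each ratio is at most the maximum, and `d` is nonnegative. This makes the rate at 0 nonnegative.
-/
theorem one_le_singularValue_zero {d : Fin 2 → ℝ} (hd : ∀ c, 0 ≤ d c) (e : R.Word) :
    1 ≤ singularValue d 0 e := by
  have h0 := ratio_pos e 0
  have h1 := ratio_pos e 1
  have hmax := max_ratio_pos e
  rw [singularValue, zero_sub, zero_sub, sub_zero, Real.rpow_neg h0.le, Real.rpow_neg h1.le,
    ← mul_inv, inv_mul_eq_div, one_le_div (by positivity), add_comm (d 0), Real.rpow_add hmax]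
  exact mul_le_mul (Real.rpow_le_rpow h0.le (le_max_left _ _) (hd 1))
    (Real.rpow_le_rpow h1.le (le_max_right _ _) (hd 0)) (by positivity) (by positivity)

end Pressure

/-! ### The almost sure rate for all parameters -/

section Main

variable {R : RIFS}

theorem upperSum_eq {ω : R.Coding} {d : Fin 2 → ℝ}
    (h : ∀ c, (upperBoxDim (shadow ω c)).toReal = d c) (k : ℕ) (s : ℝ) :
    R.upperSum ω k s = levelSum ω k (singularValue d s) := by
  refine Finset.sum_congr rfl fun j _ => ?_
  rw [← longSide_rpow_mul, ← h]
  rfl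

theorem lowerSum_eq {ω : R.Coding} {d : Fin 2 → ℝ}
    (h : ∀ c, (lowerBoxDim (shadow ω c)).toReal = d c) (k : ℕ) (s : ℝ) :
    R.lowerSum ω k s = levelSum ω k (singularValue d s) := by
  refine Finset.sum_congr rfl fun j _ => ?_
  rw [← longSide_rpow_mul, ← h]
  rfl

/-- Almost surely the growth rates exist for all parameters simultaneously, and they decrease at a
rate between two positive constants. -/
theorem exists_rate (hone : ∀ i, 1 ≤ R.numMaps i) {d : Fin 2 → ℝ}
    (hd : (∀ i j, (R.map i j).perm = 1) ∨ d 0 = d 1) (hd0 : ∀ c, 0 ≤ d c) :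
    ∃ L : ℝ → ℝ, (∀ᵐ ω ∂(R.bernoulli), ∀ s, Tendsto
        (fun n : ℕ => Real.log (levelSum ω n (singularValue d s)) / n) atTop (𝓝 (L s))) ∧
      (∀ s δ, 0 ≤ δ → L s + δ * Real.log R.lo ≤ L (s + δ) ∧
        L (s + δ) ≤ L s + δ * Real.log R.hi) ∧ 0 ≤ L 0 := by
  choose L hL using exists_tendsto_log_levelSum hone hd
  have hL' : ∀ s δ, 0 ≤ δ → L s + δ * Real.log R.lo ≤ L (s + δ) ∧
      L (s + δ) ≤ L s + δ * Real.log R.hi := by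
    intro s δ hδ
    -- One realisation where both limits exist transfers the finite-level bounds to the constants.
    obtain ⟨ω, h1, h2⟩ := ((hL s).and (hL (s + δ))).exists
    constructor
    · refine le_of_tendsto_of_tendsto (h1.add_const _) h2 ?_
      filter_upwards [eventually_gt_atTop 0] with n hn
      exact (log_levelSum_sub hone d hδ ω hn).1
    · refine le_of_tendsto_of_tendsto h2 (h1.add_const _) ?_
      filter_upwards [eventually_gt_atTop 0] with n hn
      exact (log_levelSum_sub hone d hδ ω hn).2
  refine ⟨L, ?_, hL', ?_⟩
  · have hrat : ∀ᵐ ω ∂(R.bernoulli), ∀ q : ℚ, Tendsto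
        (fun n : ℕ => Real.log (levelSum ω n (singularValue d q)) / n) atTop (𝓝 (L q)) :=
      ae_all_iff.2 fun q => hL q
    filter_upwards [hrat] with ω hω s
    have hlo : 0 < -Real.log R.lo := neg_pos.2 (Real.log_neg R.lo_pos R.lo_lt_one)
    have hhi := neg_log_hi_pos (R := R)
    rw [Metric.tendsto_atTop]
    intro ε hε
    -- Convergence at a rational `q` slightly above `s`; the choice keeps the change from `s` to `q`
    -- below `ε / 3`, both in the sequence at every positive level and in the limit.
    obtain ⟨q, hq1, hq2⟩ := exists_rat_btwn
      (show s < s + ε / 3 / -Real.log R.lo from lt_add_of_pos_right _ (by positivity))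
    set δ : ℝ := q - s with hδ
    have hδ0 : 0 ≤ δ := by linarith
    have hqs : (q : ℝ) = s + δ := by rw [hδ]; ring
    have hsmall : δ * -Real.log R.lo < ε / 3 := by
      rw [← lt_div_iff₀ hlo]
      linarith
    obtain ⟨n₀, hn₀⟩ := Metric.tendsto_atTop.1 (hω q) (ε / 3) (by positivity)
    refine ⟨max n₀ 1, fun n hn => ?_⟩
    have h1 := hn₀ n (le_of_max_le_left hn)
    have h2 := log_levelSum_sub hone d (s := s) hδ0 ω (n := n) (le_of_max_le_right hn)
    have h3 := hL' s δ hδ0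
    have h4 := mul_nonneg hδ0 hhi.le
    rw [hqs, Real.dist_eq, abs_lt] at h1
    rw [Real.dist_eq, abs_lt]
    constructor <;> linarith [h1.1, h1.2, h2.1, h2.2, h3.1, h3.2]
  · obtain ⟨ω, h⟩ := (hL 0).exists
    refine ge_of_tendsto' h fun n => div_nonneg (Real.log_nonneg ?_) (Nat.cast_nonneg n)
    exact le_levelSum hone zero_le_one fun e _ => one_le_singularValue_zero hd0 e

theorem tendsto_ofReal_rpow {u : ℕ → ℝ} (hu : ∀ n, 0 < u n) {L : ℝ}
    (h : Tendsto (fun n : ℕ => Real.log (u n) / n) atTop (𝓝 L)) :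
    Tendsto (fun n : ℕ => ENNReal.ofReal (u n ^ (1 / (n : ℝ)))) atTop
      (𝓝 (ENNReal.ofReal (Real.exp L))) := by
  refine (ENNReal.continuous_ofReal.tendsto _).comp (((Real.continuous_exp.tendsto L).comp h).congr
    fun n => ?_)
  rw [Function.comp_apply, Real.rpow_def_of_pos (hu n), mul_one_div]

end Main

end RIFS
end BoxLike
end

theorem mainTheorem6 (R : BoxLike.RIFS)
    (hone : ∀ i, 1 ≤ R.numMaps i) (htwo : ∃ i, 2 ≤ R.numMaps i) :
    ∃ P : ℝ≥0 → ℝ≥0,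
      (∀ᵐ ω ∂(R.bernoulli), ∀ s : ℝ≥0,
        R.upperPressure ω s = (P s : ℝ≥0∞) ∧ R.lowerPressure ω s = (P s : ℝ≥0∞)) ∧
      Continuous P ∧ StrictAnti P ∧ ∃! sB : ℝ≥0, P sB = 1 := by
  open BoxLike RIFS in
  obtain ⟨β, hβ, hdim⟩ := exists_box_dimensions hone
  have hβ0 : ∀ c, 0 ≤ β c := by
    obtain ⟨ω, hω⟩ := hdim.exists
    intro c
    rw [← (hω c).2]
    exact lowerBoxDim_nonneg _
  -- The projection dimensions in the singular values are defined through the same `toReal`, so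
  -- finiteness of `β` need not be established.
  obtain ⟨L, hL, hdiff, hzero⟩ := exists_rate hone (d := fun c => (β c).toReal)
    (hβ.imp_right fun h => by rw [h]) (fun c => EReal.toReal_nonneg (hβ0 c))
  have hhi := neg_log_hi_pos (R := R)
  have hanti : StrictAnti L := by
    intro s t hst
    have h1 := (hdiff s (t - s) (sub_nonneg.2 hst.le)).2
    rw [add_sub_cancel] at h1
    have := mul_pos (sub_pos.2 hst) hhi
    linarith
  have hcont : Continuous L := by
    refine (LipschitzWith.of_le_add_mul (-Real.log R.lo).toNNReal fun s t => ?_).continuous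
    rw [Real.coe_toNNReal _ (neg_nonneg.2 (Real.log_nonpos R.lo_pos.le R.lo_lt_one.le)),
      Real.dist_eq]
    have hlo := neg_nonneg.2 (Real.log_nonpos R.lo_pos.le R.lo_lt_one.le)
    rcases le_total s t with h | h
    · have h1 := (hdiff s (t - s) (sub_nonneg.2 h)).1
      rw [add_sub_cancel] at h1
      rw [abs_of_nonpos (sub_nonpos.2 h)]
      linarith
    · have h1 := hanti.antitone h
      have := mul_nonneg hlo (abs_nonneg (s - t))
      linarith
  have hPcont : Continuous fun s : ℝ≥0 => (Real.exp (L s)).toNNReal :=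
    continuous_real_toNNReal.comp (Real.continuous_exp.comp (hcont.comp NNReal.continuous_coe))
  have hPanti : StrictAnti fun s : ℝ≥0 => (Real.exp (L s)).toNNReal := by
    intro s t hst
    refine (Real.toNNReal_lt_toNNReal_iff (Real.exp_pos _)).2 (Real.exp_lt_exp.2 (hanti ?_))
    exact_mod_cast hst
  refine ⟨fun s => (Real.exp (L s)).toNNReal, ?_, hPcont, hPanti, ?_⟩
  · filter_upwards [hdim, hL] with ω hω hLω s
    have hpos := fun n => levelSum_singularValue_pos hone ω n (fun c => (β c).toReal) s
    have hlim := tendsto_ofReal_rpow hpos (hLω s)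
    constructor
    · rw [upperPressure]
      simp only [upperSum_eq (d := fun c => (β c).toReal) fun c => by rw [(hω c).1]]
      exact hlim.limsup_eq
    · rw [lowerPressure]
      simp only [lowerSum_eq (d := fun c => (β c).toReal) fun c => by rw [(hω c).2]]
      exact hlim.liminf_eq
  -- `L` falls at slope at least `-log hi`, hence is nonpositive by the time `T`.
  · set T : ℝ := L 0 / -Real.log R.hi with hT
    have hT0 : 0 ≤ T := div_nonneg hzero hhi.le
    have hLT : L T ≤ 0 := by
      have h1 := (hdiff 0 T hT0).2
      have h2 : T * -Real.log R.hi = L 0 := div_mul_cancel₀ _ hhi.ne'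
      rw [zero_add] at h1
      linarith
    obtain ⟨s, hs, hLs⟩ := intermediate_value_Icc' hT0 hcont.continuousOn ⟨hLT, hzero⟩
    have hone' : (Real.exp (L s)).toNNReal = 1 := by rw [hLs, Real.exp_zero, Real.toNNReal_one]
    refine ⟨⟨s, hs.1⟩, hone', fun t ht => hPanti.injective ?_⟩
    exact ht.trans hone'.symm
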